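/- **Notation and definitions.** *Abstract measurable and probability spaces.* A $\sigma$-complete Boolean algebra is a Boolean algebra in which every countable family has a join and a meet; $\mathbf{SigmaAlg}$ is the category of these, with the Boolean homomorphisms preserving all countable joins and meets as morphisms, and $\mathbf{AbsMes}=\mathbf{SigmaAlg}^{op}$. An $\mathbf{AbsProb}$-space is a $\sigma$-complete Boolean algebra $\Sigma_X$ with a countably additive $\mu_X$ satisfying $\mu_X(0)=0$, $\mu_X(1)=1$; a morphism $X\to Y$ is a $\mathbf{SigmaAlg}$-morphism $T^*:\Sigma_Y\to\Sigma_X$ with $\mu_X(T^*E)=\mu_Y(E)$ for all $E\in\Sigma_Y$. $\mathbf{ProbAlg}$ is the full subcategory of those $X$ with $\mu_X(E)>0$ for every $E\ne 0$, and $\mathrm{Inc}:\mathbf{ProbAlg}\to\mathbf{AbsProb}$ is the inclusion functor. *Topological spaces with measures or null ideals.* A compact Hausdorff space $K$ carries its Baire $\sigma$-algebra $\mathcal B(K)$, generated by the continuous functions $K\to\mathbb C$. A $\mathbf{CHProb}$-space is a compact Hausdorff space with a probability measure on $\mathcal B(K)$ that is Radon (inner regular on $\mathcal{B}(K)$ with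 respect to compact $G_\delta$ sets); morphisms are the continuous measure-preserving maps. A $\mathbf{CHDelete}$-space is a compact Hausdorff space with a $\sigma$-ideal $\mathcal N\subseteq\mathcal B(K)$; morphisms are the continuous maps under which preimages of sets in the ideal of the target lie in the ideal of the source. There are the evident functors $\mathbf{AbsProb}\to\mathbf{AbsMes}$ (forget $\mu$), $\mathbf{CHProb}\to\mathbf{AbsProb}$ (keep $\mathcal B(K)$ and $\mu$, with $f\mapsto f^{-1}$), $\mathbf{CHProb}\to\mathbf{CHDelete}$ (keep $K$ and the ideal of Baire sets of measure $0$) and $\mathbf{CHDelete}\to\mathbf{AbsMes}$ (keep $\mathcal B(K)$); each is written $\mathrm{Cast}$. *Loomis–Sikorski functor.* For $X\in\mathbf{AbsMes}$ with algebra $\Sigma_X$, $\mathrm{Loomis}(X)\in\mathbf{CHDelete}$ is the Stone space of all Boolean homomorphisms $\alpha:\Sigma_X\to\{0,1\}$ (topology of pointwise convergence), with the ideal of Baire-meager sets (Baire sets that are meager); on morphisms, $\mathrm{Loomis}$ is precomposition. There is a natural monomorphism $\lambda:\mathrm{id}_{\mathbf{AbsMes}}\to\mathrm{Cast}_{\mathbf{CHDelete}\to\mathbf{AbsMes}}\circ\mathrm{Loomis}$,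 given by the homomorphism $\mathcal B(\mathrm{Loomis}(X))\to\Sigma_X$ that sends a Baire set $E$ to the unique $b\in\Sigma_X$ for which $E$ and $\{\alpha:\alpha(b)=1\}$ differ by a meager set. *Canonical model functor.* For $X\in\mathbf{ProbAlg}$, $L^\infty(X)$ is the unital commutative $C^*$-algebra of bounded abstractly measurable functions on $X$, i.e. of $\mathbf{SigmaAlg}$-morphisms $f:\mathrm{Borel}(\mathbb C)\to\Sigma_X$ with $f(\{|z|\le M\})=1$ for some $M \geq 0$, with pointwise operations (the sum of $f$ and $g$ is the composition of addition $\mathbb C^2\to\mathbb C$ with the unique pairing of $f$ and $g$, and so on) and with norm the least such $M$. It carries the state $\tau(f)=\int_X f=\int_{\mathbb C}z\,d(\mu_X\circ f)(z)$. A morphism $T:X\to Y$ induces the trace-preserving unital $*$-homomorphism $L^\infty(Y)\to L^\infty(X)$, $f\mapsto T^*\circ f$. For a unital commutative $C^*$-algebra $A$ with a state $\tau$, $\mathrm{Riesz}(A,\tau)\in\mathbf{CHProb}$ is the Gelfand spectrum of $A$ with the unique Radon probability measure $\mu$ on its Baire $\sigma$-algebra such that $\int\chi(a)\,d\mu(\chi)=\tau(a)$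 for all $a\in A$; it is a contravariant functor with respect to state-preserving unital $*$-homomorphisms (acting by precomposition). Finally $\mathrm{Stone}=\mathrm{Riesz}\circ L^\infty:\mathbf{ProbAlg}\to\mathbf{CHProb}$. **Theorem 8.7 (Alternate canonical model functor).** (i) There is a unique functor $\mathrm{Stone}':\mathbf{ProbAlg}\to\mathbf{CHProb}$ such that $$\mathrm{Cast}_{\mathbf{CHProb}\to\mathbf{CHDelete}}\circ\mathrm{Stone}'=\mathrm{Loomis}\circ\mathrm{Cast}_{\mathbf{AbsProb}\to\mathbf{AbsMes}}\circ\mathrm{Inc}$$ (equality of functors) and such that the natural monomorphism, induced by $\lambda$, from $\mathrm{Cast}_{\mathbf{AbsProb}\to\mathbf{AbsMes}}\circ\mathrm{Inc}$ to $\mathrm{Cast}_{\mathbf{CHDelete}\to\mathbf{AbsMes}}\circ\mathrm{Loomis}\circ\mathrm{Cast}_{\mathbf{AbsProb}\to\mathbf{AbsMes}}\circ\mathrm{Inc}$ is promoted to (i.e. is the image under $\mathrm{Cast}_{\mathbf{AbsProb}\to\mathbf{AbsMes}}$ of) a natural monomorphism $\iota:\mathrm{Inc}\to\mathrm{Cast}_{\mathbf{CHProb}\to\mathbf{AbsProb}}\circ\mathrm{Stone}'$.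 Moreover, for every $X\in\mathbf{ProbAlg}$, a Baire subset of $\mathrm{Stone}'(X)$ has measure zero if and only if it is meager. (ii) $\mathrm{Stone}'$ is naturally isomorphic to $\mathrm{Stone}$. -/

import Mathlib

open CategoryTheory MeasureTheory Set Topology
open scoped ENNReal

universe u v w

namespace CanonModel

noncomputable section

/-- A Boolean algebra in which every countable family has a join and a meet. -/
class SigmaComplete (B : Type*) [BooleanAlgebra B] : Prop where
  exists_isLUB : ∀ E : ℕ → B, ∃ s, IsLUB (range E) s
  exists_isGLB : ∀ E : ℕ → B, ∃ s, IsGLB (range E) s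

/-- A homomorphism of Boolean algebras that preserves all countable joins and meets. -/
structure SigmaHom (A : Type*) (B : Type*) [BooleanAlgebra A] [BooleanAlgebra B]
    extends BoundedLatticeHom A B where
  map_isLUB : ∀ (E : ℕ → A) (s : A), IsLUB (range E) s →
    IsLUB (range fun n => toFun (E n)) (toFun s)
  map_isGLB : ∀ (E : ℕ → A) (s : A), IsGLB (range E) s →
    IsGLB (range fun n => toFun (E n)) (toFun s)

namespace SigmaHom

variable {A : Type*} {B : Type*} {C : Type*} [BooleanAlgebra A] [BooleanAlgebra B]
  [BooleanAlgebra C]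

instance : FunLike (SigmaHom A B) A B where
  coe f := f.toFun
  coe_injective := by
    rintro ⟨⟨⟨⟨f, _⟩, _⟩, _, _⟩, _, _⟩ ⟨⟨⟨⟨g, _⟩, _⟩, _, _⟩, _, _⟩ h
    congr

instance : BoundedLatticeHomClass (SigmaHom A B) A B where
  map_sup f := f.map_sup'
  map_inf f := f.map_inf'
  map_top f := f.map_top'
  map_bot f := f.map_bot'

@[ext] theorem ext {f g : SigmaHom A B} (h : ∀ a, f a = g a) : f = g := DFunLike.ext f g h

theorem lub (f : SigmaHom A B) {E : ℕ → A} {s : A} (h : IsLUB (range E) s) :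
    IsLUB (range fun n => f (E n)) (f s) := f.map_isLUB E s h

theorem glb (f : SigmaHom A B) {E : ℕ → A} {s : A} (h : IsGLB (range E) s) :
    IsGLB (range fun n => f (E n)) (f s) := f.map_isGLB E s h

/-- The identity homomorphism. -/
protected def id (A : Type*) [BooleanAlgebra A] : SigmaHom A A where
  toBoundedLatticeHom := BoundedLatticeHom.id A
  map_isLUB _ _ h := h
  map_isGLB _ _ h := h

/-- Composition of homomorphisms. -/
def comp (g : SigmaHom B C) (f : SigmaHom A B) : SigmaHom A C where
  toBoundedLatticeHom := g.toBoundedLatticeHom.comp f.toBoundedLatticeHom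
  map_isLUB E s h := g.map_isLUB (fun n => f (E n)) (f s) (f.map_isLUB E s h)
  map_isGLB E s h := g.map_isGLB (fun n => f (E n)) (f s) (f.map_isGLB E s h)

@[simp] theorem comp_apply (g : SigmaHom B C) (f : SigmaHom A B) (a : A) :
    g.comp f a = g (f a) := rfl

@[simp] theorem id_apply (a : A) : SigmaHom.id A a = a := rfl

theorem isGLB_of_compl {E : ℕ → A} {s : A} (h : IsLUB (range fun n => (E n)ᶜ) sᶜ) :
    IsGLB (range E) s := by
  constructor
  · rintro _ ⟨n, rfl⟩
    exact compl_le_compl_iff_le.1 (h.1 ⟨n, rfl⟩)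
  · intro t ht
    refine compl_le_compl_iff_le.1 (h.2 ?_)
    rintro _ ⟨n, rfl⟩
    exact compl_le_compl (ht ⟨n, rfl⟩)

theorem isLUB_compl {E : ℕ → A} {s : A} (h : IsGLB (range E) s) :
    IsLUB (range fun n => (E n)ᶜ) sᶜ := by
  constructor
  · rintro _ ⟨n, rfl⟩
    exact compl_le_compl (h.1 ⟨n, rfl⟩)
  · intro t ht
    refine compl_le_iff_compl_le.1 (h.2 ?_)
    rintro _ ⟨n, rfl⟩
    exact compl_le_iff_compl_le.1 (ht ⟨n, rfl⟩)

/-- A bounded lattice homomorphism preserving countable joins also preserves countable meets. -/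
def ofLUB (f : BoundedLatticeHom A B) (h : ∀ (E : ℕ → A) (s : A), IsLUB (range E) s →
    IsLUB (range fun n => f (E n)) (f s)) : SigmaHom A B where
  toBoundedLatticeHom := f
  map_isLUB := h
  map_isGLB E s hs := by
    apply isGLB_of_compl
    have := h _ _ (isLUB_compl hs)
    simpa [map_compl'] using this

end SigmaHom

/-- The `σ`-algebra of a measurable space, as a Boolean algebra. -/
abbrev MSet (X : Type*) [MeasurableSpace X] : Type _ := {s : Set X // MeasurableSet s}

section MSet

variable {X : Type*} {Y : Type*} [MeasurableSpace X] [MeasurableSpace Y]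

theorem MSet.isLUB (E : ℕ → MSet X) :
    IsLUB (range E) ⟨⋃ n, (E n).1, MeasurableSet.iUnion fun n => (E n).2⟩ := by
  constructor
  · rintro _ ⟨n, rfl⟩
    exact subset_iUnion (fun n => (E n).1) n
  · intro t ht
    exact iUnion_subset fun n => ht ⟨n, rfl⟩

theorem MSet.isGLB (E : ℕ → MSet X) :
    IsGLB (range E) ⟨⋂ n, (E n).1, MeasurableSet.iInter fun n => (E n).2⟩ := by
  constructor
  · rintro _ ⟨n, rfl⟩
    exact iInter_subset (fun n => (E n).1) n
  · intro t ht
    exact subset_iInter fun n => ht ⟨n, rfl⟩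

instance : SigmaComplete (MSet X) where
  exists_isLUB E := ⟨_, MSet.isLUB E⟩
  exists_isGLB E := ⟨_, MSet.isGLB E⟩

/-- The pullback `E ↦ f⁻¹(E)` along a measurable map. -/
def SigmaHom.preimage (f : X → Y) (hf : Measurable f) : SigmaHom (MSet Y) (MSet X) :=
  SigmaHom.ofLUB
    { toFun := fun E => ⟨f ⁻¹' E.1, hf E.2⟩
      map_sup' := fun _ _ => rfl
      map_inf' := fun _ _ => rfl
      map_top' := rfl
      map_bot' := rfl }
    (by
      intro E s hs
      have h := MSet.isLUB fun n => (⟨f ⁻¹' (E n).1, hf (E n).2⟩ : MSet X)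
      have e : s = ⟨⋃ n, (E n).1, MeasurableSet.iUnion fun n => (E n).2⟩ := hs.unique (MSet.isLUB E)
      subst e
      have e : (⟨f ⁻¹' ⋃ n, (E n).1, hf (MeasurableSet.iUnion fun n => (E n).2)⟩ : MSet X) =
          ⟨⋃ n, f ⁻¹' (E n).1, MeasurableSet.iUnion fun n => hf (E n).2⟩ :=
        Subtype.ext preimage_iUnion
      change IsLUB _ (⟨f ⁻¹' ⋃ n, (E n).1, hf (MeasurableSet.iUnion fun n => (E n).2)⟩ : MSet X)
      rw [e]
      exact h)

@[simp] theorem SigmaHom.preimage_apply (f : X → Y) (hf : Measurable f) (E : MSet Y) :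
    SigmaHom.preimage f hf E = ⟨f ⁻¹' E.1, hf E.2⟩ := rfl

theorem SigmaHom.map_iUnion {B : Type*} [BooleanAlgebra B] (φ : SigmaHom (MSet X) B)
    (E : ℕ → Set X) (hE : ∀ n, MeasurableSet (E n)) :
    IsLUB (range fun n => φ ⟨E n, hE n⟩) (φ ⟨⋃ n, E n, MeasurableSet.iUnion hE⟩) :=
  φ.lub (MSet.isLUB fun n => ⟨E n, hE n⟩)

theorem SigmaHom.map_iInter {B : Type*} [BooleanAlgebra B] (φ : SigmaHom (MSet X) B)
    (E : ℕ → Set X) (hE : ∀ n, MeasurableSet (E n)) :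
    IsGLB (range fun n => φ ⟨E n, hE n⟩) (φ ⟨⋂ n, E n, MeasurableSet.iInter hE⟩) :=
  φ.glb (MSet.isGLB fun n => ⟨E n, hE n⟩)

/-- Two homomorphisms that agree on a generating family of sets are equal. -/
theorem SigmaHom.ext_of_generate {B : Type*} [BooleanAlgebra B] (φ ψ : SigmaHom (MSet X) B)
    (S : Set (Set X)) (hS : ‹MeasurableSpace X› = MeasurableSpace.generateFrom S)
    (h : ∀ (s : Set X) (_ : s ∈ S) (hs : MeasurableSet s), φ ⟨s, hs⟩ = ψ ⟨s, hs⟩) : φ = ψ := by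
  have key : ∀ s, MeasurableSet[MeasurableSpace.generateFrom S] s →
      ∀ hs : MeasurableSet s, φ ⟨s, hs⟩ = ψ ⟨s, hs⟩ := by
    intro s hs
    induction s, hs using MeasurableSpace.generateFrom_induction with
    | hC t ht _ => exact h t ht
    | empty => exact fun _ => (map_bot φ).trans (map_bot ψ).symm
    | compl t ht ih =>
      intro hs
      have ht' : MeasurableSet t := by rw [hS]; exact ht
      have e : (⟨tᶜ, hs⟩ : MSet X) = (⟨t, ht'⟩ : MSet X)ᶜ := rfl
      rw [e, map_compl', map_compl', ih]
    | iUnion E hE ih =>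
      intro hs
      have hE' : ∀ n, MeasurableSet (E n) := fun n => by rw [hS]; exact hE n
      have h1 := φ.map_iUnion E hE'
      have h2 := ψ.map_iUnion E hE'
      simp only [ih _ (hE' _)] at h1
      exact h1.unique h2
  ext ⟨s, hs⟩
  exact key s (by rw [← hS]; exact hs) hs

end MSet

/-- The category of `σ`-complete Boolean algebras. -/
structure SigmaAlg : Type (u + 1) where
  carrier : Type u
  [str : BooleanAlgebra carrier]
  [sigma : SigmaComplete carrier]

namespace SigmaAlg

instance : CoeSort SigmaAlg.{u} (Type u) := ⟨SigmaAlg.carrier⟩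

instance (A : SigmaAlg.{u}) : BooleanAlgebra A := A.str

instance (A : SigmaAlg.{u}) : SigmaComplete A := A.sigma

instance : Category SigmaAlg.{u} where
  Hom A B := SigmaHom A B
  id A := SigmaHom.id A
  comp f g := SigmaHom.comp g f

end SigmaAlg

/-- Abstract measurable spaces: the opposite of the category of `σ`-complete Boolean algebras. -/
abbrev AbsMes : Type (u + 1) := SigmaAlg.{u}ᵒᵖ

/-- Abstract probability spaces: a `σ`-complete Boolean algebra with a countably additive
probability measure. (The values automatically lie in `[0, 1]`.) -/
structure AbsProb : Type (u + 1) where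
  alg : SigmaAlg.{u}
  μ : alg → ℝ≥0∞
  μ_bot : μ ⊥ = 0
  μ_top : μ ⊤ = 1
  μ_lub : ∀ (E : ℕ → alg) (s : alg), Pairwise (fun m n => Disjoint (E m) (E n)) →
    IsLUB (range E) s → μ s = ∑' n, μ (E n)

namespace AbsProb

/-- A morphism `X ⟶ Y` of abstract probability spaces is an abstractly measurable map, that is, a
homomorphism from the algebra of `Y` to that of `X`, which is measure-preserving. -/
structure Hom (X Y : AbsProb.{u}) where
  pull : SigmaHom Y.alg X.alg
  measure_pull : ∀ E : Y.alg, X.μ (pull E) = Y.μ E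

@[ext] theorem Hom.ext {X Y : AbsProb.{u}} {f g : Hom X Y} (h : f.pull = g.pull) : f = g := by
  cases f; cases g; congr

instance : Category AbsProb.{u} where
  Hom := Hom
  id X := ⟨SigmaHom.id X.alg, fun _ => rfl⟩
  comp f g := ⟨f.pull.comp g.pull, fun E => (f.measure_pull _).trans (g.measure_pull E)⟩

/-- The forgetful functor to abstract measurable spaces. -/
def toAbsMes : AbsProb.{u} ⥤ AbsMes.{u} where
  obj X := Opposite.op X.alg
  map {X Y} f := Quiver.Hom.op (show Y.alg ⟶ X.alg from f.pull)

end AbsProb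

/-- Probability algebras: abstract probability spaces in which every nonzero element has positive
measure. -/
abbrev ProbAlg : Type (u + 1) :=
  ObjectProperty.FullSubcategory fun X : AbsProb.{u} => ∀ E : X.alg, E ≠ ⊥ → 0 < X.μ E

/-- The inclusion functor from probability algebras to abstract probability spaces. -/
abbrev Inc : ProbAlg.{u} ⥤ AbsProb.{u} := ObjectProperty.ι _

/-- The Baire `σ`-algebra of a topological space: the one generated by the continuous
complex-valued functions. -/
abbrev baire (X : Type*) [TopologicalSpace X] : MeasurableSpace X :=
  ⨆ f : C(X, ℂ), MeasurableSpace.comap f (borel ℂ)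

section Baire

variable {X : Type*} {Y : Type*} [TopologicalSpace X] [TopologicalSpace Y]

theorem baire_measurable_coe (f : C(X, ℂ)) : @Measurable X ℂ (baire X) _ f := by
  rw [measurable_iff_comap_le, BorelSpace.measurable_eq (α := ℂ)]
  exact le_iSup (fun f : C(X, ℂ) => MeasurableSpace.comap f (borel ℂ)) f

theorem baire_measurable_real (f : C(X, ℝ)) : @Measurable X ℝ (baire X) _ f := by
  have h := baire_measurable_coe (⟨fun x => (f x : ℂ), by fun_prop⟩ : C(X, ℂ))
  exact Complex.measurable_re.comp h

theorem baire_measurable (f : C(X, Y)) : @Measurable X Y (baire X) (baire Y) f := by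
  rw [measurable_iff_comap_le, MeasurableSpace.comap_iSup]
  refine iSup_le fun g => ?_
  rw [MeasurableSpace.comap_comp]
  exact le_iSup (fun f : C(X, ℂ) => MeasurableSpace.comap f (borel ℂ)) (g.comp f)

theorem baire_le_borel : baire X ≤ borel X := by
  refine iSup_le fun f => ?_
  rw [← measurable_iff_comap_le]
  borelize X
  have := f.continuous.measurable
  rwa [BorelSpace.measurable_eq (α := ℂ)] at this

/-- Every Baire set is pulled back from `ℂ^ℕ` by a continuous map. -/
theorem baire_exists {E : Set X} (hE : MeasurableSet[baire X] E) :
    ∃ (g : C(X, ℕ → ℂ)) (A : Set (ℕ → ℂ)), MeasurableSet A ∧ g ⁻¹' A = E := by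
  have hgen : baire X = MeasurableSpace.generateFrom
      {s | ∃ f : C(X, ℂ), ∃ t, MeasurableSet[borel ℂ] t ∧ f ⁻¹' t = s} := by
    apply le_antisymm
    · refine iSup_le fun f s hs => ?_
      exact MeasurableSpace.measurableSet_generateFrom ⟨f, hs⟩
    · refine MeasurableSpace.generateFrom_le ?_
      rintro _ ⟨f, t, ht, rfl⟩
      exact le_iSup (fun f : C(X, ℂ) => MeasurableSpace.comap f (borel ℂ)) f _ ⟨t, ht, rfl⟩
  rw [hgen] at hE
  induction E, hE using MeasurableSpace.generateFrom_induction with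
  | hC t ht _ =>
    obtain ⟨f, t, ht, rfl⟩ := ht
    rw [← BorelSpace.measurable_eq (α := ℂ)] at ht
    exact ⟨⟨fun x _ => f x, by fun_prop⟩, (fun z => z 0) ⁻¹' t, measurable_pi_apply 0 ht, rfl⟩
  | empty => exact ⟨⟨fun _ _ => 0, by fun_prop⟩, ∅, MeasurableSet.empty, rfl⟩
  | compl t _ ih =>
    obtain ⟨g, A, hA, rfl⟩ := ih
    exact ⟨g, Aᶜ, hA.compl, rfl⟩
  | iUnion E _ ih =>
    choose g A hA h using ih
    have hm : ∀ n, Measurable fun (z : ℕ → ℂ) k => z (Nat.pair n k) := fun n =>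
      measurable_pi_lambda _ fun k => measurable_pi_apply _
    refine ⟨⟨fun x m => g m.unpair.1 x m.unpair.2, ?_⟩,
      ⋃ n, (fun (z : ℕ → ℂ) k => z (Nat.pair n k)) ⁻¹' (A n),
      MeasurableSet.iUnion fun n => hm n (hA n), ?_⟩
    · refine continuous_pi fun m => ?_
      exact (continuous_apply _).comp (g _).continuous
    · rw [preimage_iUnion]
      refine iUnion_congr fun n => ?_
      rw [← h n]
      ext x
      simp

theorem baire_measurable_pi (g : C(X, ℕ → ℂ)) : @Measurable X (ℕ → ℂ) (baire X) _ g := by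
  refine @measurable_pi_lambda _ _ _ (baire X) _ _ fun n => ?_
  exact baire_measurable_coe (⟨fun x => g x n, by fun_prop⟩ : C(X, ℂ))

/-- A finite measure on the Baire `σ`-algebra is determined by the integrals of continuous
functions. -/
theorem baire_measure_ext (μ ν : @Measure X (baire X)) [IsFiniteMeasure μ] [IsFiniteMeasure ν]
    (h : ∀ f : C(X, ℂ), ∫ x, f x ∂μ = ∫ x, f x ∂ν) : μ = ν := by
  let : MeasurableSpace X := baire X
  ext E hE
  obtain ⟨g, A, hA, rfl⟩ := baire_exists hE
  have hg : Measurable g := baire_measurable_pi g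
  have hmap : μ.map g = ν.map g := by
    apply ext_of_forall_integral_eq_of_IsFiniteMeasure
    intro f
    rw [integral_map hg.aemeasurable f.continuous.aestronglyMeasurable,
      integral_map hg.aemeasurable f.continuous.aestronglyMeasurable]
    have := h ⟨fun x => (f (g x) : ℂ), by fun_prop⟩
    simp only [ContinuousMap.coe_mk, integral_complex_ofReal] at this
    exact_mod_cast this
  rw [← Measure.map_apply hg hA, ← Measure.map_apply hg hA, hmap]

/-- The Radon property of a Baire measure: inner regularity with respect to (Baire measurable)
compact `Gδ` sets. -/
abbrev IsRadon (μ : @Measure X (baire X)) : Prop :=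
  Measure.InnerRegularWRT μ (fun K => IsCompact K ∧ IsGδ K ∧ MeasurableSet[baire X] K)
    (fun E => MeasurableSet[baire X] E)

/-- On a compact space every finite Baire measure is Radon. -/
theorem isRadon [CompactSpace X] (μ : @Measure X (baire X)) [IsFiniteMeasure μ] : IsRadon μ := by
  let : MeasurableSpace X := baire X
  intro E hE r hr
  obtain ⟨g, A, hA, rfl⟩ := baire_exists hE
  have hg : Measurable g := baire_measurable_pi g
  rw [← Measure.map_apply hg hA] at hr
  obtain ⟨F, hFA, hF, hr⟩ := hA.exists_lt_isClosed_of_ne_top (measure_ne_top _ _) hr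
  rw [Measure.map_apply hg hF.measurableSet] at hr
  let := TopologicalSpace.upgradeIsCompletelyMetrizable (ℕ → ℂ)
  exact ⟨g ⁻¹' F, preimage_mono hFA, ⟨(hF.preimage g.continuous).isCompact,
    hF.isGδ.preimage g.continuous, hg hF.measurableSet⟩, hr⟩

end Baire

/-- A compact Hausdorff space is equipped with its Baire `σ`-algebra. -/
instance (X : CompHaus.{u}) : MeasurableSpace X := baire X

theorem measurable_compHaus {X Y : CompHaus.{u}} (f : X ⟶ Y) : Measurable f :=
  baire_measurable (X := X) (Y := Y) (ConcreteCategory.hom f)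

/-- The functor taking a compact Hausdorff space to its Baire `σ`-algebra, viewed as an abstract
measurable space. -/
def chToAbsMes : CompHaus.{u} ⥤ AbsMes.{u} where
  obj X := Opposite.op ⟨MSet X⟩
  map {X Y} f := Quiver.Hom.op
    (show (⟨MSet Y⟩ : SigmaAlg.{u}) ⟶ ⟨MSet X⟩ from SigmaHom.preimage f (measurable_compHaus f))

/-- Compact Hausdorff spaces with a Radon probability measure on the Baire `σ`-algebra. -/
structure CHProb : Type (u + 1) where
  top : CompHaus.{u}
  μ : Measure top
  prob : IsProbabilityMeasure μ
  radon : IsRadon μ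

namespace CHProb

/-- Morphisms are the continuous measure-preserving maps. -/
structure Hom (X Y : CHProb.{u}) where
  toCH : X.top ⟶ Y.top
  map_eq : X.μ.map toCH = Y.μ

@[ext] theorem Hom.ext {X Y : CHProb.{u}} {f g : Hom X Y} (h : f.toCH = g.toCH) : f = g := by
  cases f; cases g; congr

instance : Category CHProb.{u} where
  Hom := Hom
  id X := ⟨𝟙 X.top, by simp⟩
  comp {X Y Z} f g := ⟨f.toCH ≫ g.toCH, by
    rw [← g.map_eq, ← f.map_eq,
      Measure.map_map (measurable_compHaus _) (measurable_compHaus _)]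
    rfl⟩

/-- The casting functor to abstract probability spaces: the Baire `σ`-algebra with the measure. -/
def toAbsProb : CHProb.{u} ⥤ AbsProb.{u} where
  obj X :=
    { alg := ⟨MSet X.top⟩
      μ := fun E => X.μ E.1
      μ_bot := measure_empty
      μ_top := X.prob.measure_univ
      μ_lub := by
        intro E s hd hs
        have e := hs.unique (MSet.isLUB E)
        subst e
        refine measure_iUnion (fun m n hmn => ?_) fun n => (E n).2
        have := (hd hmn).eq_bot
        refine disjoint_iff.2 ?_
        exact congrArg Subtype.val this }
  map {X Y} f :=
    { pull := SigmaHom.preimage f.toCH (measurable_compHaus _)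
      measure_pull := fun E => by
        change X.μ (f.toCH ⁻¹' E.1) = Y.μ E.1
        rw [← f.map_eq, Measure.map_apply (measurable_compHaus _) E.2] }

end CHProb

/-- Compact Hausdorff spaces with a `σ`-ideal of null sets in the Baire `σ`-algebra. -/
structure CHDelete : Type (u + 1) where
  top : CompHaus.{u}
  null : Set (MSet top)
  bot_mem : ⊥ ∈ null
  mem_of_le : ∀ E F : MSet top, E ≤ F → F ∈ null → E ∈ null
  lub_mem : ∀ (E : ℕ → MSet top) (s : MSet top), (∀ n, E n ∈ null) → IsLUB (range E) s → s ∈ null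

namespace CHDelete

/-- Morphisms are the continuous maps such that null sets pull back to null sets. -/
structure Hom (X Y : CHDelete.{u}) where
  toCH : X.top ⟶ Y.top
  preimage_mem : ∀ E ∈ Y.null, SigmaHom.preimage toCH (measurable_compHaus toCH) E ∈ X.null

@[ext] theorem Hom.ext {X Y : CHDelete.{u}} {f g : Hom X Y} (h : f.toCH = g.toCH) : f = g := by
  cases f; cases g; congr

instance : Category CHDelete.{u} where
  Hom := Hom
  id X := ⟨𝟙 X.top, fun _ h => h⟩
  comp f g := ⟨f.toCH ≫ g.toCH, fun E h => f.preimage_mem _ (g.preimage_mem E h)⟩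

/-- The forgetful functor to compact Hausdorff spaces. -/
def toCH : CHDelete.{u} ⥤ CompHaus.{u} where
  obj X := X.top
  map f := f.toCH

/-- The casting functor to abstract measurable spaces. -/
abbrev toAbsMes : CHDelete.{u} ⥤ AbsMes.{u} := toCH ⋙ chToAbsMes

end CHDelete

/-- The casting functor remembering only the space and the sets of measure zero. -/
def CHProb.toCHDelete : CHProb.{u} ⥤ CHDelete.{u} where
  obj X :=
    { top := X.top
      null := {E | X.μ E.1 = 0}
      bot_mem := measure_empty
      mem_of_le := fun _ _ h hF => measure_mono_null h hF
      lub_mem := by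
        intro E s hE hs
        have e := hs.unique (MSet.isLUB E)
        subst e
        exact measure_iUnion_null hE }
  map {X Y} f :=
    { toCH := f.toCH
      preimage_mem := fun E (hE : Y.μ E.1 = 0) => by
        change X.μ (f.toCH ⁻¹' E.1) = 0
        rwa [← f.map_eq, Measure.map_apply (measurable_compHaus _) E.2] at hE }

theorem CHProb.toAbsProb_comp_toAbsMes :
    CHProb.toAbsProb.{u} ⋙ AbsProb.toAbsMes = CHProb.toCHDelete ⋙ CHDelete.toAbsMes := rfl

/-- The Stone space of a Boolean algebra: the space of homomorphisms to `{0, 1}`. -/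
def StoneSpace (B : Type u) [BooleanAlgebra B] : Type u := BoundedLatticeHom B Bool

namespace StoneSpace

section Bool

variable {B : Type u} [BooleanAlgebra B]

instance : FunLike (StoneSpace B) B Bool := inferInstanceAs (FunLike (BoundedLatticeHom B Bool) B Bool)

instance : BoundedLatticeHomClass (StoneSpace B) B Bool :=
  inferInstanceAs (BoundedLatticeHomClass (BoundedLatticeHom B Bool) B Bool)

/-- The topology of pointwise convergence, induced from the product `{0, 1}^B`. -/
instance : TopologicalSpace (StoneSpace B) :=
  TopologicalSpace.induced (fun α (b : B) => α b) inferInstance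

theorem isInducing_coe : IsInducing fun (α : StoneSpace B) (b : B) => α b := ⟨rfl⟩

theorem continuous_eval (b : B) : Continuous fun α : StoneSpace B => α b :=
  (continuous_apply b).comp isInducing_coe.continuous

theorem range_coe : range (fun (α : StoneSpace B) (b : B) => α b) =
    {f | f ⊤ = true ∧ f ⊥ = false ∧ (∀ a b, f (a ⊔ b) = (f a || f b)) ∧
      ∀ a b, f (a ⊓ b) = (f a && f b)} := by
  ext f
  constructor
  · rintro ⟨α, rfl⟩
    exact ⟨map_top α, map_bot α, map_sup α, map_inf α⟩
  · rintro ⟨h1, h2, h3, h4⟩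
    exact ⟨({ toFun := f, map_sup' := h3, map_inf' := h4, map_top' := h1, map_bot' := h2 } :
      BoundedLatticeHom B Bool), rfl⟩

instance : T2Space (StoneSpace B) :=
  T2Space.of_injective_continuous (f := fun (α : StoneSpace B) (b : B) => α b)
    DFunLike.coe_injective isInducing_coe.continuous

instance : CompactSpace (StoneSpace B) := by
  have hc : IsClosed (range (fun (α : StoneSpace B) (b : B) => α b)) := by
    rw [range_coe]
    have hcont : ∀ b : B, Continuous fun f : B → Bool => f b := fun b => continuous_apply b
    have h3 : IsClosed {f : B → Bool | ∀ a b, f (a ⊔ b) = (f a || f b)} := by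
      simp only [ofPred_forall]
      refine isClosed_iInter fun a => isClosed_iInter fun b => isClosed_eq (hcont _) ?_
      exact (continuous_of_discreteTopology (f := fun p : Bool × Bool => (p.1 || p.2))).comp
        ((hcont a).prodMk (hcont b))
    have h4 : IsClosed {f : B → Bool | ∀ a b, f (a ⊓ b) = (f a && f b)} := by
      simp only [ofPred_forall]
      refine isClosed_iInter fun a => isClosed_iInter fun b => isClosed_eq (hcont _) ?_
      exact (continuous_of_discreteTopology (f := fun p : Bool × Bool => (p.1 && p.2))).comp
        ((hcont a).prodMk (hcont b))
    exact (isClosed_eq (hcont _) continuous_const).inter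
      ((isClosed_eq (hcont _) continuous_const).inter (h3.inter h4))
  exact (IsClosedEmbedding.mk ⟨isInducing_coe, DFunLike.coe_injective⟩ hc).compactSpace

/-- The clopen set of the Stone space associated with an element of the algebra. -/
def basic (b : B) : Set (StoneSpace B) := {α | α b = true}

theorem mem_basic {b : B} {α : StoneSpace B} : α ∈ basic b ↔ α b = true := Iff.rfl

theorem isClopen_basic (b : B) : IsClopen (basic b) :=
  (isClopen_discrete {true}).preimage (continuous_eval b)

theorem basic_bot : basic (⊥ : B) = ∅ := by
  ext α; simp [mem_basic]

theorem basic_sup (a b : B) : basic (a ⊔ b) = basic a ∪ basic b := by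
  ext α; simp [mem_basic]

theorem basic_inf (a b : B) : basic (a ⊓ b) = basic a ∩ basic b := by
  ext α; simp [mem_basic]

theorem basic_top : basic (⊤ : B) = univ := by
  ext α; simp [mem_basic]

theorem basic_compl (a : B) : basic aᶜ = (basic a)ᶜ := by
  ext α; simp [mem_basic]

theorem basic_mono {a b : B} (h : a ≤ b) : basic a ⊆ basic b := by
  rw [← sup_eq_right.2 h, basic_sup]
  exact subset_union_left

theorem basic_nonempty {b : B} (hb : b ≠ ⊥) : (basic b).Nonempty := by
  obtain ⟨J, hJ, -, hd⟩ := DistribLattice.prime_ideal_of_disjoint_filter_ideal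
    (F := Order.PFilter.principal b) (I := Order.Ideal.principal (⊥ : B)) (by
      rw [Set.disjoint_left]
      intro x hx hx'
      have h1 : b ≤ x := hx
      have h2 : x ≤ ⊥ := hx'
      exact hb (le_bot_iff.1 (h1.trans h2)))
  have hbJ : b ∉ J := fun h => Set.disjoint_left.1 hd (show b ≤ b from le_rfl) h
  classical
  have hinf : ∀ x y, x ⊓ y ∈ J ↔ x ∈ J ∨ y ∈ J := fun x y =>
    ⟨hJ.mem_or_mem, fun h => h.elim (J.lower inf_le_left) (J.lower inf_le_right)⟩
  refine ⟨({ toFun := fun x => decide (x ∉ J), map_sup' := ?_, map_inf' := ?_, map_top' := ?_,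
             map_bot' := ?_ } : BoundedLatticeHom B Bool), ?_⟩
  · intro x y
    by_cases hx : x ∈ J <;> by_cases hy : y ∈ J <;> simp [Order.Ideal.sup_mem_iff, hx, hy]
  · intro x y
    by_cases hx : x ∈ J <;> by_cases hy : y ∈ J <;> simp [hinf, hx, hy]
  · have := hJ.toIsProper.top_notMem
    simp [this]
  · simp
  · exact decide_eq_true hbJ

theorem basic_subset_iff {a b : B} : basic a ⊆ basic b ↔ a ≤ b := by
  refine ⟨fun h => ?_, basic_mono⟩
  by_contra hab
  have hne : a ⊓ bᶜ ≠ ⊥ := fun h =>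
    hab (disjoint_compl_right_iff.1 (disjoint_iff.2 h))
  obtain ⟨α, hα⟩ := basic_nonempty hne
  rw [basic_inf, basic_compl] at hα
  exact hα.2 (h hα.1)

theorem exists_basic {U : Set (StoneSpace B)} (hU : IsOpen U) {α : StoneSpace B} (hα : α ∈ U) :
    ∃ b, α ∈ basic b ∧ basic b ⊆ U := by
  obtain ⟨V, hV, rfl⟩ := isOpen_induced_iff.1 hU
  obtain ⟨I, u, hu, hsub⟩ := isOpen_pi_iff.1 hV _ hα
  refine ⟨I.inf fun b => if α b then b else bᶜ, ?_, ?_⟩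
  · rw [mem_basic, map_finset_inf]
    refine (Finset.inf_eq_top_iff _ _).2 fun b _ => ?_
    by_cases h : α b <;> simp [h]
  · intro β hβ
    refine hsub fun b hb => ?_
    have h1 : β (if α b then b else bᶜ) = true := basic_mono (Finset.inf_le hb) hβ
    have h2 : β b = α b := by
      by_cases h : α b <;> simpa [h, map_compl'] using h1
    change β b ∈ u b
    rw [h2]
    exact (hu b hb).2

/-- A compact set inside an open set can be separated from the complement by a basic clopen set. -/
theorem exists_basic_between {K U : Set (StoneSpace B)} (hK : IsCompact K) (hU : IsOpen U)
    (h : K ⊆ U) : ∃ b, K ⊆ basic b ∧ basic b ⊆ U := by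
  refine hK.induction_on (p := fun s => ∃ b, s ⊆ basic b ∧ basic b ⊆ U)
    ⟨⊥, empty_subset _, by simp [basic_bot]⟩ ?_ ?_ ?_
  · rintro s t hst ⟨b, hb, hb'⟩
    exact ⟨b, hst.trans hb, hb'⟩
  · rintro s t ⟨a, ha, ha'⟩ ⟨b, hb, hb'⟩
    exact ⟨a ⊔ b, by rw [basic_sup]; exact union_subset_union ha hb,
      by rw [basic_sup]; exact union_subset ha' hb'⟩
  · intro x hx
    obtain ⟨b, hxb, hb⟩ := exists_basic hU (h hx)
    exact ⟨basic b, mem_nhdsWithin_of_mem_nhds ((isClopen_basic b).isOpen.mem_nhds hxb), b,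
      Subset.rfl, hb⟩

instance : MeasurableSpace (StoneSpace B) := baire _

theorem measurableSet_clopen {C : Set (StoneSpace B)} (hC : IsClopen C) : MeasurableSet C := by
  classical
  have h := baire_measurable_coe (X := StoneSpace B)
    ⟨C.indicator fun _ => 1, (continuous_const).indicator (by simp [hC.frontier_eq])⟩
  have e : C = (C.indicator fun _ => (1 : ℂ)) ⁻¹' {1} := by
    ext x; by_cases hx : x ∈ C <;> simp [hx]
  rw [e]
  exact h (measurableSet_singleton _)

theorem measurableSet_basic (b : B) : MeasurableSet (basic b) :=
  measurableSet_clopen (isClopen_basic b)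

theorem generate_basic : (inferInstance : MeasurableSpace (StoneSpace B)) =
    MeasurableSpace.generateFrom (range basic) := by
  apply le_antisymm
  · refine iSup_le fun f => ?_
    rw [← BorelSpace.measurable_eq (α := ℂ), ← measurable_iff_comap_le]
    refine @measurable_of_isClosed _ _ _ _ _ (MeasurableSpace.generateFrom (range basic)) _ ?_
    intro K hK
    have hUo : ∀ n : ℕ, IsOpen (Metric.thickening (1 / ((n : ℝ) + 1)) K) := fun n =>
      Metric.isOpen_thickening
    have := fun n : ℕ => exists_basic_between (hK.preimage f.continuous).isCompact
      ((hUo n).preimage f.continuous)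
      (preimage_mono (Metric.self_subset_thickening (by positivity) K))
    choose b hb1 hb2 using this
    have e : f ⁻¹' K = ⋂ n, basic (b n) := by
      refine Subset.antisymm (subset_iInter hb1) ?_
      intro x hx
      have hx' : ∀ n : ℕ, f x ∈ Metric.thickening (1 / ((n : ℝ) + 1)) K := fun n =>
        hb2 n (mem_iInter.1 hx n)
      change f x ∈ K
      rw [← hK.closure_eq, Metric.mem_closure_iff]
      intro ε hε
      obtain ⟨n, hn⟩ := exists_nat_one_div_lt hε
      obtain ⟨z, hz, hz'⟩ := Metric.mem_thickening_iff.1 (hx' n)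
      exact ⟨z, hz, hz'.trans hn⟩
    rw [e]
    exact MeasurableSet.iInter fun n => MeasurableSpace.measurableSet_generateFrom ⟨b n, rfl⟩
  · refine MeasurableSpace.generateFrom_le ?_
    rintro _ ⟨b, rfl⟩
    exact measurableSet_basic b

end Bool

section Sigma

variable {B : Type u} [BooleanAlgebra B]

theorem basic_eq_of_meagre {a b : B} (h : IsMeagre (symmDiff (basic a) (basic b))) : a = b := by
  have ho : IsOpen (symmDiff (basic a) (basic b)) :=
    ((isClopen_basic a).diff (isClopen_basic b)).isOpen.union
      ((isClopen_basic b).diff (isClopen_basic a)).isOpen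
  have he : symmDiff (basic a) (basic b) = ∅ := by
    by_contra hne
    exact not_isMeagre_of_isOpen ho (nonempty_iff_ne_empty.2 hne) h
  have hab : basic a = basic b := symmDiff_eq_bot.1 he
  exact le_antisymm (basic_subset_iff.1 hab.le) (basic_subset_iff.1 hab.ge)

theorem meagre_symmDiff_trans {X : Type*} [TopologicalSpace X] {E F G : Set X}
    (h1 : IsMeagre (symmDiff E F)) (h2 : IsMeagre (symmDiff F G)) : IsMeagre (symmDiff E G) :=
  (h1.union h2).mono (symmDiff_triangle E F G)

/-- The union of countably many basic clopen sets differs from the basic clopen set of the join by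
a meager set. -/
theorem meagre_lub {b : ℕ → B} {s : B} (h : IsLUB (range b) s) :
    IsMeagre (symmDiff (⋃ n, basic (b n)) (basic s)) := by
  have hsub : ⋃ n, basic (b n) ⊆ basic s := iUnion_subset fun n => basic_mono (h.1 ⟨n, rfl⟩)
  have hcl : IsClosed (basic s \ ⋃ n, basic (b n)) :=
    (isClopen_basic s).isClosed.sdiff (isOpen_iUnion fun n => (isClopen_basic _).isOpen)
  have e : symmDiff (⋃ n, basic (b n)) (basic s) = basic s \ ⋃ n, basic (b n) := by
    rw [Set.symmDiff_def, sdiff_eq_empty.2 hsub, empty_union]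
  rw [e]
  refine IsNowhereDense.isMeagre (hcl.isNowhereDense_iff.2 ?_)
  by_contra hne
  obtain ⟨α, hα⟩ := nonempty_iff_ne_empty.2 hne
  obtain ⟨c, hαc, hc⟩ := exists_basic isOpen_interior hα
  have hc' := hc.trans interior_subset
  have h1 : c ≤ s := basic_subset_iff.1 (hc'.trans sdiff_subset)
  have h2 : s ≤ cᶜ := by
    refine h.2 ?_
    rintro _ ⟨n, rfl⟩
    rw [← basic_subset_iff, basic_compl]
    intro β hβ hβc
    exact (hc' hβc).2 (mem_iUnion.2 ⟨n, hβ⟩)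
  have h3 : c ≤ cᶜ := h1.trans h2
  have h4 := basic_subset_iff.2 h3 hαc
  rw [basic_compl] at h4
  exact h4 hαc

theorem meagre_op {E E' F F' : Set (StoneSpace B)} (op : Set (StoneSpace B) → Set (StoneSpace B) →
    Set (StoneSpace B)) (hop : symmDiff (op E E') (op F F') ⊆ symmDiff E F ∪ symmDiff E' F')
    (h : IsMeagre (symmDiff E F)) (h' : IsMeagre (symmDiff E' F')) :
    IsMeagre (symmDiff (op E E') (op F F')) := (h.union h').mono hop

variable [SigmaComplete B]

theorem exists_class {E : Set (StoneSpace B)} (hE : MeasurableSet E) :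
    ∃ b, IsMeagre (symmDiff E (basic b)) := by
  replace hE : MeasurableSet[MeasurableSpace.generateFrom (range basic)] E := by
    rw [← generate_basic]; exact hE
  induction E, hE using MeasurableSpace.generateFrom_induction with
  | hC t ht _ =>
    obtain ⟨b, rfl⟩ := ht
    exact ⟨b, by simpa using IsMeagre.empty⟩
  | empty => exact ⟨⊥, by simpa [basic_bot] using IsMeagre.empty⟩
  | compl t _ ih =>
    obtain ⟨b, hb⟩ := ih
    refine ⟨bᶜ, ?_⟩
    rw [basic_compl]
    rwa [show symmDiff tᶜ (basic b)ᶜ = symmDiff t (basic b) from compl_symmDiff_compl _ _]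
  | iUnion E _ ih =>
    choose b hb using ih
    obtain ⟨s, hs⟩ := SigmaComplete.exists_isLUB b
    refine ⟨s, meagre_symmDiff_trans ?_ (meagre_lub hs)⟩
    refine (isMeagre_iUnion hb).mono ?_
    rintro x (⟨hx, hx'⟩ | ⟨hx, hx'⟩)
    · obtain ⟨n, hn⟩ := mem_iUnion.1 hx
      exact mem_iUnion.2 ⟨n, Or.inl ⟨hn, fun h => hx' (mem_iUnion.2 ⟨n, h⟩)⟩⟩
    · obtain ⟨n, hn⟩ := mem_iUnion.1 hx
      exact mem_iUnion.2 ⟨n, Or.inr ⟨hn, fun h => hx' (mem_iUnion.2 ⟨n, h⟩)⟩⟩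

/-- The unique element of the algebra whose clopen set agrees with a given Baire set of the Stone
space up to a meager set. -/
def lsClass (E : MSet (StoneSpace B)) : B := (exists_class E.2).choose

theorem lsClass_spec (E : MSet (StoneSpace B)) :
    IsMeagre (symmDiff E.1 (basic (lsClass E))) := (exists_class E.2).choose_spec

theorem lsClass_eq {E : MSet (StoneSpace B)} {b : B} (h : IsMeagre (symmDiff E.1 (basic b))) :
    lsClass E = b := by
  refine basic_eq_of_meagre (meagre_symmDiff_trans ?_ h)
  rw [symmDiff_comm]
  exact lsClass_spec E

/-- The homomorphism from the Baire `σ`-algebra of the Stone space of `B` to `B`, with kernel the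
Baire-meager sets. -/
def lsHom (B : Type u) [BooleanAlgebra B] [SigmaComplete B] :
    SigmaHom (MSet (StoneSpace B)) B :=
  SigmaHom.ofLUB
    { toFun := lsClass
      map_sup' := fun E F => by
        apply lsClass_eq
        rw [basic_sup]
        refine meagre_op (· ∪ ·) ?_ (lsClass_spec E) (lsClass_spec F)
        intro x
        simp only [mem_symmDiff, mem_union]
        tauto
      map_inf' := fun E F => by
        apply lsClass_eq
        rw [basic_inf]
        refine meagre_op (· ∩ ·) ?_ (lsClass_spec E) (lsClass_spec F)
        intro x
        simp only [mem_symmDiff, mem_union, mem_inter_iff]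
        tauto
      map_top' := lsClass_eq (by
        rw [basic_top]
        change IsMeagre (symmDiff univ univ)
        simpa using IsMeagre.empty)
      map_bot' := lsClass_eq (by
        rw [basic_bot]
        change IsMeagre (symmDiff ∅ ∅)
        simpa using IsMeagre.empty) }
    (by
      intro E s hs
      have e := hs.unique (MSet.isLUB E)
      subst e
      change IsLUB (range fun n => lsClass (E n)) (lsClass _)
      obtain ⟨t, ht⟩ := SigmaComplete.exists_isLUB fun n => lsClass (E n)
      rw [lsClass_eq (b := t)]
      · exact ht
      · refine meagre_symmDiff_trans ?_ (meagre_lub ht)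
        refine (isMeagre_iUnion fun n => lsClass_spec (E n)).mono ?_
        rintro x (⟨hx, hx'⟩ | ⟨hx, hx'⟩)
        · obtain ⟨n, hn⟩ := mem_iUnion.1 hx
          exact mem_iUnion.2 ⟨n, Or.inl ⟨hn, fun h => hx' (mem_iUnion.2 ⟨n, h⟩)⟩⟩
        · obtain ⟨n, hn⟩ := mem_iUnion.1 hx
          exact mem_iUnion.2 ⟨n, Or.inr ⟨hn, fun h => hx' (mem_iUnion.2 ⟨n, h⟩)⟩⟩)

theorem lsHom_eq {E : MSet (StoneSpace B)} {b : B} (h : IsMeagre (symmDiff E.1 (basic b))) :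
    lsHom B E = b := lsClass_eq h

theorem lsHom_basic (b : B) : lsHom B ⟨basic b, measurableSet_basic b⟩ = b :=
  lsClass_eq (by simpa using IsMeagre.empty)

theorem lsHom_eq_bot {E : MSet (StoneSpace B)} : lsHom B E = ⊥ ↔ IsMeagre E.1 := by
  constructor
  · intro h
    have := lsClass_spec E
    rw [show lsClass E = ⊥ from h, basic_bot] at this
    rwa [show symmDiff E.1 ∅ = E.1 from symmDiff_bot _] at this
  · intro h
    refine lsHom_eq ?_
    rwa [basic_bot, show symmDiff E.1 ∅ = E.1 from symmDiff_bot _]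

end Sigma

/-- The continuous map of Stone spaces given by composition with a homomorphism. -/
def map {A B : Type u} [BooleanAlgebra A] [BooleanAlgebra B] (φ : SigmaHom A B) :
    C(StoneSpace B, StoneSpace A) where
  toFun α := BoundedLatticeHom.comp α φ.toBoundedLatticeHom
  continuous_toFun := by
    refine isInducing_coe.continuous_iff.2 (continuous_pi fun a => ?_)
    exact continuous_eval (φ a)

@[simp] theorem map_apply {A B : Type u} [BooleanAlgebra A] [BooleanAlgebra B] (φ : SigmaHom A B)
    (α : StoneSpace B) (a : A) : map φ α a = α (φ a) := rfl

theorem lsHom_naturality {A B : Type u} [BooleanAlgebra A] [BooleanAlgebra B] [SigmaComplete A]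
    [SigmaComplete B] (φ : SigmaHom A B) :
    (lsHom B).comp (SigmaHom.preimage (map φ) (baire_measurable (map φ))) = φ.comp (lsHom A) := by
  refine SigmaHom.ext_of_generate _ _ (range basic) generate_basic ?_
  rintro _ ⟨a, rfl⟩ ha
  change lsHom B ⟨basic (φ a), _⟩ = φ (lsHom A ⟨basic a, _⟩)
  rw [lsHom_basic, lsHom_basic]

end StoneSpace

/-- The Loomis–Sikorski functor: the Stone space of a `σ`-complete Boolean algebra, with the ideal
of Baire-meager sets (Baire sets that are meager) as null ideal. -/
def Loomis : AbsMes.{u} ⥤ CHDelete.{u} where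
  obj B :=
    { top := CompHaus.of (StoneSpace B.unop)
      null := {E | IsMeagre E.1}
      bot_mem := IsMeagre.empty
      mem_of_le := fun _ _ h hF => hF.mono h
      lub_mem := by
        intro E s hE hs
        have e := hs.unique (MSet.isLUB E)
        subst e
        exact isMeagre_iUnion hE }
  map {A B} f :=
    { toCH := CompHausLike.ofHom _ (StoneSpace.map (show SigmaHom B.unop A.unop from f.unop))
      preimage_mem := by
        intro (E : MSet (StoneSpace B.unop)) (hE : IsMeagre E.1)
        have h := DFunLike.congr_fun
          (StoneSpace.lsHom_naturality (show SigmaHom B.unop A.unop from f.unop)) E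
        rw [SigmaHom.comp_apply, SigmaHom.comp_apply, StoneSpace.lsHom_eq_bot.2 hE, map_bot] at h
        exact StoneSpace.lsHom_eq_bot.1 h }

/-- The natural transformation from an abstract measurable space `X` to the Baire `σ`-algebra of
its Loomis–Sikorski model. The underlying homomorphism sends a Baire set of the Stone space to the
unique element of `X` whose clopen set agrees with it modulo a meager set. -/
def loomisInclusion : 𝟭 AbsMes.{u} ⟶ Loomis ⋙ CHDelete.toAbsMes where
  app B := Quiver.Hom.op (show (⟨MSet (StoneSpace B.unop)⟩ : SigmaAlg.{u}) ⟶ B.unop from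
    StoneSpace.lsHom B.unop)
  naturality A B f := Quiver.Hom.unop_inj
    (StoneSpace.lsHom_naturality (show SigmaHom B.unop A.unop from f.unop)).symm

theorem loomisInclusion_mono (B : AbsMes.{u}) : Mono (loomisInclusion.app B) where
  right_cancellation {Z} f g h := by
    have h' := congrArg Quiver.Hom.unop h
    apply Quiver.Hom.unop_inj
    refine SigmaHom.ext fun b => ?_
    have := DFunLike.congr_fun (F := SigmaHom (MSet (StoneSpace B.unop)) Z.unop) h'
      ⟨StoneSpace.basic b, StoneSpace.measurableSet_basic b⟩
    change (show SigmaHom B.unop Z.unop from f.unop) (StoneSpace.lsHom B.unop _) =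
      (show SigmaHom B.unop Z.unop from g.unop) (StoneSpace.lsHom B.unop _) at this
    rwa [StoneSpace.lsHom_basic] at this

/-- The ball `{|z| ≤ M}` as a Borel set of `ℂ`. -/
def cball (M : ℝ) : MSet ℂ := ⟨{z | ‖z‖ ≤ M}, (isClosed_le continuous_norm continuous_const).measurableSet⟩

/-- The bounded abstractly measurable functions on an abstract measurable space with algebra `B`:
homomorphisms `f` from the Borel `σ`-algebra of `ℂ` to `B` with `f({|z| ≤ M}) = 1` for some `M`. -/
def LInf (B : Type u) [BooleanAlgebra B] : Type u :=
  {f : SigmaHom (MSet ℂ) B // ∃ M : ℝ, 0 ≤ M ∧ f (cball M) = ⊤}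

namespace LInf

section

variable {B : Type u} [BooleanAlgebra B]

theorem ext {f g : LInf B} (h : f.1 = g.1) : f = g := Subtype.ext h

theorem pair_unique {h h' : SigmaHom (MSet (ℂ × ℂ)) B}
    (h1 : h.comp (SigmaHom.preimage Prod.fst measurable_fst) =
      h'.comp (SigmaHom.preimage Prod.fst measurable_fst))
    (h2 : h.comp (SigmaHom.preimage Prod.snd measurable_snd) =
      h'.comp (SigmaHom.preimage Prod.snd measurable_snd)) : h = h' := by
  refine SigmaHom.ext_of_generate _ _ _ generateFrom_prod.symm ?_
  rintro _ ⟨s, hs, t, ht, rfl⟩ hst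
  have e : (⟨s ×ˢ t, hst⟩ : MSet (ℂ × ℂ)) =
      SigmaHom.preimage Prod.fst measurable_fst ⟨s, hs⟩ ⊓
        SigmaHom.preimage Prod.snd measurable_snd ⟨t, ht⟩ := Subtype.ext rfl
  rw [e, map_inf, map_inf]
  exact congrArg₂ _ (DFunLike.congr_fun h1 ⟨s, hs⟩) (DFunLike.congr_fun h2 ⟨t, ht⟩)

theorem measurable_pair (a b : C(StoneSpace B, ℂ)) : Measurable fun x => (a x, b x) :=
  (baire_measurable_coe a).prodMk (baire_measurable_coe b)

variable [SigmaComplete B]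

/-- A measurable function on the Stone space induces an abstractly measurable function. -/
def realize {Z : Type*} [MeasurableSpace Z] (g : StoneSpace B → Z) (hg : Measurable g) :
    SigmaHom (MSet Z) B := (StoneSpace.lsHom B).comp (SigmaHom.preimage g hg)

theorem realize_apply {Z : Type*} [MeasurableSpace Z] (g : StoneSpace B → Z) (hg : Measurable g)
    (E : MSet Z) : realize g hg E = StoneSpace.lsHom B ⟨g ⁻¹' E.1, hg E.2⟩ := rfl

theorem realize_cball (g : C(StoneSpace B, ℂ)) {M : ℝ} (hM : 0 ≤ M) :
    realize g (baire_measurable_coe g) (cball M) = ⊤ ↔ ‖g‖ ≤ M := by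
  rw [realize_apply, ← compl_eq_bot, ← map_compl', StoneSpace.lsHom_eq_bot,
    ContinuousMap.norm_le g hM]
  constructor
  · intro h x
    by_contra hx
    refine not_isMeagre_of_isOpen (s := {x | ‖g x‖ ≤ M}ᶜ) ?_ ⟨x, hx⟩ h
    exact (isClosed_le (by fun_prop) continuous_const).isOpen_compl
  · intro h
    have e : ((⟨g ⁻¹' (cball M).1, baire_measurable_coe g (cball M).2⟩ : MSet (StoneSpace B))ᶜ).1
        = ∅ := by
      change (g ⁻¹' {z | ‖z‖ ≤ M})ᶜ = ∅
      rw [compl_empty_iff]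
      exact eq_univ_of_forall h
    rw [e]
    exact IsMeagre.empty

/-- A continuous function on the Stone space induces a bounded abstractly measurable function. -/
def ofCont (g : C(StoneSpace B, ℂ)) : LInf B :=
  ⟨realize g (baire_measurable_coe g), ‖g‖, norm_nonneg _, (realize_cball g (norm_nonneg _)).2 le_rfl⟩

theorem ofCont_injective : Function.Injective (ofCont (B := B)) := by
  intro g g' h
  ext x
  by_contra hne
  obtain ⟨U, V, hU, hV, hxU, hxV, hd⟩ := t2_separation hne
  have h1 : realize g (baire_measurable_coe g) ⟨U, hU.measurableSet⟩ =
      realize g' (baire_measurable_coe g') ⟨U, hU.measurableSet⟩ := by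
    have := congrArg Subtype.val h
    exact DFunLike.congr_fun this _
  rw [realize_apply, realize_apply] at h1
  have hm : IsMeagre (g ⁻¹' U ∩ g' ⁻¹' V) := by
    have h2 := congrArg (· ⊓ StoneSpace.lsHom B ⟨g' ⁻¹' V, baire_measurable_coe g' hV.measurableSet⟩) h1
    simp only [← map_inf] at h2
    refine StoneSpace.lsHom_eq_bot.1 (h2.trans (StoneSpace.lsHom_eq_bot.2 ?_))
    change IsMeagre (g' ⁻¹' U ∩ g' ⁻¹' V)
    rw [← preimage_inter, hd.inter_eq, preimage_empty]
    exact IsMeagre.empty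
  exact not_isMeagre_of_isOpen ((hU.preimage g.continuous).inter (hV.preimage g'.continuous))
    ⟨x, hxU, hxV⟩ hm

theorem ofCont_surjective : Function.Surjective (ofCont (B := B)) := by
  rintro ⟨f, M, hM, hf⟩
  have hlim : ∀ α : StoneSpace B, ∃ z : ℂ, ∀ (U : Set ℂ) (hU : IsOpen U), z ∈ U →
      α (f ⟨U, hU.measurableSet⟩) = true := by
    intro α
    by_contra! hcon
    have hcomp : IsCompact (cball M).1 := by
      have : (cball M).1 = Metric.closedBall 0 M := by ext z; simp [cball]
      rw [this]; exact isCompact_closedBall 0 M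
    have := hcomp.induction_on (p := fun s => ∃ E : MSet ℂ, s ⊆ E.1 ∧ α (f E) = false)
      ⟨⊥, empty_subset _, by simp⟩ (fun s t hst ⟨E, hE, h⟩ => ⟨E, hst.trans hE, h⟩)
      (fun s t ⟨E, hE, h⟩ ⟨F, hF, h'⟩ => ⟨E ⊔ F, union_subset_union hE hF, by
        rw [map_sup, map_sup, h, h']; rfl⟩)
      (fun z _ => by
        obtain ⟨U, hU, hz, h⟩ := hcon z
        exact ⟨U, mem_nhdsWithin_of_mem_nhds (hU.mem_nhds hz), ⟨U, hU.measurableSet⟩,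
          Subset.rfl, by simpa using h⟩)
    obtain ⟨E, hE, h⟩ := this
    have h1 : f (cball M) ≤ f E := OrderHomClass.mono f hE
    rw [hf, top_le_iff] at h1
    rw [h1, map_top] at h
    simp at h
  choose z hz using hlim
  have hdisj : ∀ (α : StoneSpace B) (U : MSet ℂ) (V : Set ℂ), IsOpen V → z α ∈ V →
      α (f U) = true → (U.1 ∩ V).Nonempty := by
    intro α U V hV hzV hU
    by_contra hne
    have h1 := hz α V hV hzV
    have h2 : α (f (U ⊓ ⟨V, hV.measurableSet⟩)) = true := by
      rw [map_inf, map_inf, hU, h1]; rfl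
    have h3 : U ⊓ ⟨V, hV.measurableSet⟩ = (⊥ : MSet ℂ) :=
      Subtype.ext (not_nonempty_iff_eq_empty.1 hne)
    rw [h3, map_bot, map_bot] at h2
    exact absurd h2 (by decide)
  have hcont : Continuous z := by
    rw [Metric.continuous_iff']
    intro α ε hε
    have hα := hz α (Metric.ball (z α) (ε / 2)) Metric.isOpen_ball (Metric.mem_ball_self (by positivity))
    filter_upwards [(StoneSpace.isClopen_basic _).isOpen.mem_nhds hα] with β hβ
    obtain ⟨w, hw1, hw2⟩ := hdisj β _ (Metric.ball (z β) (ε / 2)) Metric.isOpen_ball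
      (Metric.mem_ball_self (by positivity)) hβ
    have h1 : dist w (z α) < ε / 2 := hw1
    have h2 : dist w (z β) < ε / 2 := hw2
    have := dist_triangle_left (z β) (z α) w
    linarith
  refine ⟨⟨z, hcont⟩, ext ?_⟩
  refine SigmaHom.ext_of_generate _ _ {K | IsClosed K} ?_ ?_
  · rw [BorelSpace.measurable_eq (α := ℂ)]
    exact borel_eq_generateFrom_isClosed
  · intro K hK hKm
    replace hK : IsClosed K := hK
    have hopen : ∀ n : ℕ, IsOpen (Metric.thickening (1 / ((n : ℝ) + 1)) K) := fun n =>
      Metric.isOpen_thickening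
    have hK' : K = ⋂ n : ℕ, Metric.thickening (1 / ((n : ℝ) + 1)) K := by
      refine Subset.antisymm (subset_iInter fun n =>
        Metric.self_subset_thickening (by positivity) K) fun w hw => ?_
      rw [← hK.closure_eq, Metric.mem_closure_iff]
      intro ε hε
      obtain ⟨n, hn⟩ := exists_nat_one_div_lt hε
      obtain ⟨y, hy, hy'⟩ := Metric.mem_thickening_iff.1 (mem_iInter.1 hw n)
      exact ⟨y, hy, hy'.trans hn⟩
    have hpre : z ⁻¹' K =
        ⋂ n : ℕ, StoneSpace.basic (f ⟨Metric.thickening (1 / ((n : ℝ) + 1)) K, (hopen n).measurableSet⟩) := by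
      ext α
      constructor
      · intro hα
        exact mem_iInter.2 fun n => hz α _ (hopen n)
          (Metric.self_subset_thickening (by positivity) K hα)
      · intro hα
        change z α ∈ K
        rw [← hK.closure_eq, Metric.mem_closure_iff]
        intro ε hε
        obtain ⟨n, hn⟩ := exists_nat_one_div_lt (half_pos hε)
        obtain ⟨w, hw1, hw2⟩ := hdisj α _ (Metric.ball (z α) (ε / 2)) Metric.isOpen_ball
          (Metric.mem_ball_self (by positivity)) (mem_iInter.1 hα n)
        obtain ⟨y, hy, hy'⟩ := Metric.mem_thickening_iff.1 hw1
        have h2 : dist w (z α) < ε / 2 := hw2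
        refine ⟨y, hy, ?_⟩
        have := dist_triangle_left (z α) y w
        linarith
    have g1 := (StoneSpace.lsHom B).map_iInter _ fun n : ℕ => StoneSpace.measurableSet_basic
      (f ⟨Metric.thickening (1 / ((n : ℝ) + 1)) K, (hopen n).measurableSet⟩)
    have g2 := f.map_iInter _ fun n => (hopen n).measurableSet
    simp only [StoneSpace.lsHom_basic] at g1
    have e1 := g1.unique g2
    change StoneSpace.lsHom B ⟨z ⁻¹' K, _⟩ = _
    have e2 : ∀ h, (⟨z ⁻¹' K, h⟩ : MSet (StoneSpace B)) = ⟨_, MeasurableSet.iInter fun n : ℕ =>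
      StoneSpace.measurableSet_basic
      (f ⟨Metric.thickening (1 / ((n : ℝ) + 1)) K, (hopen n).measurableSet⟩)⟩ :=
      fun _ => Subtype.ext hpre
    rw [e2, e1]
    congr 1
    exact Subtype.ext hK'.symm

/-- Bounded abstractly measurable functions correspond to continuous functions on the Stone
space. -/
def toCont : LInf B ≃ C(StoneSpace B, ℂ) :=
  (Equiv.ofBijective ofCont ⟨ofCont_injective, ofCont_surjective⟩).symm

theorem toCont_ofCont (g : C(StoneSpace B, ℂ)) : toCont (ofCont g) = g :=
  (Equiv.ofBijective ofCont ⟨ofCont_injective, ofCont_surjective⟩).symm_apply_apply g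

theorem ofCont_toCont (f : LInf B) : ofCont (toCont f) = f :=
  (Equiv.ofBijective ofCont ⟨ofCont_injective, ofCont_surjective⟩).apply_symm_apply f


theorem exists_pair (f g : LInf B) : ∃ h : SigmaHom (MSet (ℂ × ℂ)) B,
    h.comp (SigmaHom.preimage Prod.fst measurable_fst) = f.1 ∧
    h.comp (SigmaHom.preimage Prod.snd measurable_snd) = g.1 := by
  refine ⟨realize _ (measurable_pair (toCont f) (toCont g)), ?_, ?_⟩
  · conv_rhs => rw [← ofCont_toCont f]
    rfl
  · conv_rhs => rw [← ofCont_toCont g]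
    rfl

/-- The unique abstractly measurable map to `ℂ × ℂ` with given (bounded) components. -/
def pair (f g : LInf B) : SigmaHom (MSet (ℂ × ℂ)) B := (exists_pair f g).choose

theorem pair_fst (f g : LInf B) :
    (pair f g).comp (SigmaHom.preimage Prod.fst measurable_fst) = f.1 :=
  (exists_pair f g).choose_spec.1

theorem pair_snd (f g : LInf B) :
    (pair f g).comp (SigmaHom.preimage Prod.snd measurable_snd) = g.1 :=
  (exists_pair f g).choose_spec.2

theorem pair_ofCont (a b : C(StoneSpace B, ℂ)) :
    pair (ofCont a) (ofCont b) = realize _ (measurable_pair a b) :=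
  pair_unique (pair_fst _ _) (pair_snd _ _)

theorem comp_pair_ofCont (op : ℂ × ℂ → ℂ) (hop : Continuous op) (a b : C(StoneSpace B, ℂ)) :
    (pair (ofCont a) (ofCont b)).comp (SigmaHom.preimage op hop.measurable) =
      (ofCont ⟨fun x => op (a x, b x), by fun_prop⟩).1 := by
  rw [pair_ofCont]
  rfl

/-- The binary operation on bounded abstractly measurable functions induced by a continuous
operation `op` on `ℂ`: the composition of `op` with the pairing. -/
def map₂ (op : ℂ × ℂ → ℂ) (hop : Continuous op) (f g : LInf B) : LInf B :=
  ⟨(pair f g).comp (SigmaHom.preimage op hop.measurable), by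
    rw [← ofCont_toCont f, ← ofCont_toCont g, comp_pair_ofCont op hop]
    exact (ofCont _).2⟩

/-- The unary operation induced by a continuous operation `op` on `ℂ`: composition with `op`. -/
def map (op : ℂ → ℂ) (hop : Continuous op) (f : LInf B) : LInf B :=
  ⟨f.1.comp (SigmaHom.preimage op hop.measurable), by
    rw [← ofCont_toCont f]
    exact (ofCont ⟨fun x => op (toCont f x), by fun_prop⟩).2⟩

open Classical in
theorem const_aux (c : ℂ) (E : MSet ℂ) :
    (if c ∈ E.1 then ⊤ else ⊥) = (ofCont (ContinuousMap.const (StoneSpace B) c)).1 E := by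
  change _ = StoneSpace.lsHom B ⟨(fun _ => c) ⁻¹' E.1, _⟩
  by_cases h : c ∈ E.1
  · simp only [h, if_true, preimage_const_of_mem]
    exact (map_top (StoneSpace.lsHom B)).symm
  · simp only [h, if_false, preimage_const_of_notMem, not_false_eq_true]
    exact (map_bot (StoneSpace.lsHom B)).symm

open Classical in
/-- The constant function `c`: `E ↦ 1` if `c ∈ E`, and `E ↦ 0` otherwise. -/
def const (c : ℂ) : LInf B :=
  ⟨{ toFun := fun E => if c ∈ E.1 then ⊤ else ⊥
     map_sup' := fun E F => by simp only [const_aux]; exact map_sup _ E F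
     map_inf' := fun E F => by simp only [const_aux]; exact map_inf _ E F
     map_top' := by simp only [const_aux]; exact map_top _
     map_bot' := by simp only [const_aux]; exact map_bot _
     map_isLUB := fun E s h => by simp only [const_aux]; exact SigmaHom.lub _ h
     map_isGLB := fun E s h => by simp only [const_aux]; exact SigmaHom.glb _ h },
    ‖c‖, norm_nonneg c, if_pos (show ‖c‖ ≤ ‖c‖ from le_rfl)⟩

instance : Zero (LInf B) := ⟨const 0⟩
instance : One (LInf B) := ⟨const 1⟩
instance : Add (LInf B) := ⟨map₂ (fun p => p.1 + p.2) (by fun_prop)⟩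
instance : Mul (LInf B) := ⟨map₂ (fun p => p.1 * p.2) (by fun_prop)⟩
instance : Neg (LInf B) := ⟨map (fun z => -z) (by fun_prop)⟩
instance : SMul ℂ (LInf B) := ⟨fun c => map (fun z => c * z) (by fun_prop)⟩
instance : Star (LInf B) := ⟨map (fun z => star z) (by fun_prop)⟩

/-- The norm: the infimum of all `M ≥ 0` with `|f| ≤ M`. -/
instance : Norm (LInf B) := ⟨fun f => sInf {M : ℝ | 0 ≤ M ∧ f.1 (cball M) = ⊤}⟩

theorem toCont_const (c : ℂ) : toCont (const c : LInf B) = ContinuousMap.const _ c := by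
  rw [← toCont_ofCont (ContinuousMap.const (StoneSpace B) c)]
  congr 1
  refine ext (SigmaHom.ext fun E => ?_)
  exact const_aux c E

theorem toCont_map (op : ℂ → ℂ) (hop : Continuous op) (f : LInf B) :
    toCont (map op hop f) = ⟨fun x => op (toCont f x), by fun_prop⟩ := by
  rw [← toCont_ofCont ⟨fun x => op (toCont f x), _⟩]
  congr 1
  refine ext ?_
  conv_lhs => rw [← ofCont_toCont f]
  rfl

theorem toCont_map₂ (op : ℂ × ℂ → ℂ) (hop : Continuous op) (f g : LInf B) :
    toCont (map₂ op hop f g) = ⟨fun x => op (toCont f x, toCont g x), by fun_prop⟩ := by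
  rw [← toCont_ofCont ⟨fun x => op (toCont f x, toCont g x), _⟩]
  congr 1
  refine ext ?_
  conv_lhs => rw [← ofCont_toCont f, ← ofCont_toCont g]
  exact comp_pair_ofCont op hop _ _

@[simp] theorem toCont_zero : toCont (0 : LInf B) = 0 := toCont_const 0
@[simp] theorem toCont_one : toCont (1 : LInf B) = 1 := toCont_const 1
@[simp] theorem toCont_add (f g : LInf B) : toCont (f + g) = toCont f + toCont g :=
  toCont_map₂ _ _ f g
@[simp] theorem toCont_mul (f g : LInf B) : toCont (f * g) = toCont f * toCont g :=
  toCont_map₂ _ _ f g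
@[simp] theorem toCont_neg (f : LInf B) : toCont (-f) = -toCont f := toCont_map _ _ f
@[simp] theorem toCont_smul (c : ℂ) (f : LInf B) : toCont (c • f) = c • toCont f :=
  toCont_map _ _ f
@[simp] theorem toCont_star (f : LInf B) : toCont (star f) = star (toCont f) := toCont_map _ _ f

theorem norm_eq (f : LInf B) : ‖f‖ = ‖toCont f‖ := by
  have e : {M : ℝ | 0 ≤ M ∧ f.1 (cball M) = ⊤} = Ici ‖toCont f‖ := by
    ext M
    constructor
    · rintro ⟨h0, h⟩
      rw [← ofCont_toCont f] at h
      exact (realize_cball _ h0).1 h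
    · intro h
      have h0 : 0 ≤ M := (norm_nonneg _).trans h
      refine ⟨h0, ?_⟩
      rw [← ofCont_toCont f]
      exact (realize_cball _ h0).2 h
  change sInf _ = _
  rw [e, csInf_Ici]

instance : CommRing (LInf B) where
  add_assoc f g h := toCont.injective (by simp [add_assoc])
  zero_add f := toCont.injective (by simp)
  add_zero f := toCont.injective (by simp)
  add_comm f g := toCont.injective (by simp [add_comm])
  left_distrib f g h := toCont.injective (by simp [mul_add])
  right_distrib f g h := toCont.injective (by simp [add_mul])
  zero_mul f := toCont.injective (by simp)
  mul_zero f := toCont.injective (by simp)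
  mul_assoc f g h := toCont.injective (by simp [mul_assoc])
  one_mul f := toCont.injective (by simp)
  mul_one f := toCont.injective (by simp)
  neg_add_cancel f := toCont.injective (by simp)
  mul_comm f g := toCont.injective (by simp [mul_comm])
  nsmul := nsmulRec
  zsmul := zsmulRec

instance : Module ℂ (LInf B) where
  one_smul f := toCont.injective (by simp)
  mul_smul c d f := toCont.injective (by simp [mul_smul])
  smul_zero c := toCont.injective (by simp)
  smul_add c f g := toCont.injective (by simp)
  add_smul c d f := toCont.injective (by simp [add_smul])
  zero_smul f := toCont.injective (by simp)

instance : Algebra ℂ (LInf B) :=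
  Algebra.ofModule (fun c f g => toCont.injective (by simp))
    (fun c f g => toCont.injective (by simp))

instance : StarRing (LInf B) where
  star_involutive f := toCont.injective (by simp)
  star_mul f g := toCont.injective (by simp [mul_comm])
  star_add f g := toCont.injective (by simp)

/-- The isomorphism of `*`-algebras with the continuous functions on the Stone space. -/
def toContHom : LInf B ≃⋆ₐ[ℂ] C(StoneSpace B, ℂ) where
  toEquiv := toCont
  map_mul' := toCont_mul
  map_add' := toCont_add
  map_star' := toCont_star
  map_smul' := toCont_smul

theorem toCont_sub (f g : LInf B) : toCont (f - g) = toCont f - toCont g :=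
  map_sub (toContHom (B := B)) f g

instance : NormedCommRing (LInf B) where
  dist f g := ‖-f + g‖
  dist_self f := by simp [norm_eq]
  dist_comm f g := by
    rw [norm_eq, norm_eq, ← norm_neg]; simp [add_comm]
  dist_triangle f g h := by
    rw [norm_eq, norm_eq, norm_eq]
    refine (norm_add_le _ _).trans' (le_of_eq ?_)
    congr 1
    simp
  eq_of_dist_eq_zero {f g} h := by
    rw [norm_eq, norm_eq_zero] at h
    refine toCont.injective ?_
    simp only [toCont_add, toCont_neg] at h
    exact (neg_add_eq_zero.1 h)
  dist_eq f g := rfl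
  norm_mul_le f g := by
    rw [norm_eq, norm_eq, norm_eq, toCont_mul]
    exact norm_mul_le _ _
  mul_comm := mul_comm

theorem isometry_toCont : Isometry (toCont : LInf B ≃ C(StoneSpace B, ℂ)) := by
  refine Isometry.of_dist_eq fun f g => ?_
  rw [dist_eq_norm, dist_eq_norm, ← toCont_sub, norm_eq]

/-- Bounded abstractly measurable functions form a unital commutative `C⋆`-algebra. -/
instance : CommCStarAlgebra (LInf B) where
  mul_comm := mul_comm
  complete := by
    have : CompleteSpace (LInf B) :=
      (isometry_toCont (B := B)).isUniformInducing.completeSpace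
        (by rw [toCont.surjective.range_eq]; exact isClosed_univ.isComplete)
    exact fun {_} hf => this.complete hf
  norm_mul_self_le f := by
    rw [norm_eq, norm_eq, toCont_mul, toCont_star]
    exact CStarRing.norm_mul_self_le _
  norm_smul_le c f := by
    rw [norm_eq, norm_eq, toCont_smul]
    exact norm_smul_le _ _
  star_smul c f := toCont.injective (by simp)

end

end LInf

namespace AbsProb

variable (X : AbsProb.{u})

/-- The distribution of an abstractly measurable function on an abstract probability space. -/
def push {Z : Type*} [MeasurableSpace Z] (f : SigmaHom (MSet Z) X.alg) : Measure Z :=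
  Measure.ofMeasurable (fun s hs => X.μ (f ⟨s, hs⟩))
    (by
      have : f (⊥ : MSet Z) = ⊥ := map_bot f
      exact (congrArg X.μ this).trans X.μ_bot)
    (by
      intro E hE hd
      refine X.μ_lub (fun n => f ⟨E n, hE n⟩) _ (fun m n hmn => ?_) (f.map_iUnion E hE)
      have h : (⟨E m, hE m⟩ : MSet Z) ⊓ ⟨E n, hE n⟩ = ⊥ :=
        Subtype.ext (disjoint_iff_inter_eq_empty.1 (hd hmn))
      refine disjoint_iff.2 ?_
      rw [← map_inf, h, map_bot])

theorem push_apply {Z : Type*} [MeasurableSpace Z] (f : SigmaHom (MSet Z) X.alg) {s : Set Z}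
    (hs : MeasurableSet s) : X.push f s = X.μ (f ⟨s, hs⟩) :=
  Measure.ofMeasurable_apply s hs

instance {Z : Type*} [MeasurableSpace Z] (f : SigmaHom (MSet Z) X.alg) :
    IsProbabilityMeasure (X.push f) where
  measure_univ := by
    rw [push_apply X f MeasurableSet.univ]
    have : f (⊤ : MSet Z) = ⊤ := map_top f
    exact (congrArg X.μ this).trans X.μ_top

theorem push_preimage {Z W : Type*} [MeasurableSpace Z] [MeasurableSpace W]
    (f : SigmaHom (MSet Z) X.alg) (g : Z → W) (hg : Measurable g) :
    X.push (f.comp (SigmaHom.preimage g hg)) = (X.push f).map g := by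
  ext s hs
  rw [Measure.map_apply hg hs, push_apply X _ hs, push_apply X f (hg hs)]
  rfl

/-- The trace on bounded abstractly measurable functions: the integral `∫_X f`, that is, the mean
of the distribution of `f`. -/
def trace (f : LInf X.alg) : ℂ := ∫ z, z ∂(X.push f.1)

theorem trace_eq (f : LInf X.alg) :
    X.trace f = ∫ x, LInf.toCont f x ∂(X.push (StoneSpace.lsHom X.alg)) := by
  conv_lhs => rw [← LInf.ofCont_toCont f]
  change ∫ z, z ∂(X.push ((StoneSpace.lsHom X.alg).comp
    (SigmaHom.preimage _ (baire_measurable_coe (LInf.toCont f))))) = _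
  rw [push_preimage]
  exact integral_map (f := fun z : ℂ => z) (baire_measurable_coe _).aemeasurable
    measurable_id.aestronglyMeasurable

end AbsProb

theorem integrable_cont {Y : Type*} [TopologicalSpace Y] [CompactSpace Y] (μ : @Measure Y (baire Y))
    [IsFiniteMeasure μ] (f : C(Y, ℂ)) : Integrable f μ := by
  let : MeasurableSpace Y := baire Y
  exact Integrable.of_bound (baire_measurable_coe f).aestronglyMeasurable ‖f‖
    (Filter.Eventually.of_forall f.norm_coe_le_norm)

open ComplexOrder in
/-- Unital commutative `C⋆`-algebras with a state `τ`. -/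
structure CStarTr : Type (u + 1) where
  carrier : Type u
  [str : CommCStarAlgebra carrier]
  τ : carrier →ₗ[ℂ] ℂ
  τ_one : τ 1 = 1
  τ_nonneg : ∀ a, 0 ≤ τ (star a * a)

namespace CStarTr

instance : CoeSort CStarTr.{u} (Type u) := ⟨CStarTr.carrier⟩

instance (A : CStarTr.{u}) : CommCStarAlgebra A := A.str

/-- Morphisms are the unital `*`-homomorphisms that preserve the state. -/
structure Hom (A B : CStarTr.{u}) where
  toHom : A →⋆ₐ[ℂ] B
  τ_map : ∀ a, B.τ (toHom a) = A.τ a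

@[ext] theorem Hom.ext {A B : CStarTr.{u}} {f g : Hom A B} (h : f.toHom = g.toHom) : f = g := by
  cases f; cases g; congr

instance : Category CStarTr.{u} where
  Hom := Hom
  id A := ⟨StarAlgHom.id ℂ A, fun _ => rfl⟩
  comp f g := ⟨g.toHom.comp f.toHom, fun a => (g.τ_map _).trans (f.τ_map a)⟩

end CStarTr

namespace LInf

open ComplexOrder in
/-- The tracial `C⋆`-algebra of bounded abstractly measurable functions. -/
def obj (X : AbsProb.{u}) : CStarTr.{u} where
  carrier := LInf X.alg
  τ :=
    { toFun := X.trace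
      map_add' := fun f g => by
        simp only [AbsProb.trace_eq, toCont_add, ContinuousMap.add_apply]
        exact integral_add (integrable_cont _ _) (integrable_cont _ _)
      map_smul' := fun c f => by
        simp only [AbsProb.trace_eq, toCont_smul, ContinuousMap.smul_apply, RingHom.id_apply]
        exact integral_smul _ _ }
  τ_one := by
    change X.trace 1 = 1
    simp [AbsProb.trace_eq]
  τ_nonneg f := by
    change 0 ≤ X.trace (star f * f)
    rw [AbsProb.trace_eq]
    have e : ∀ x, toCont (star f * f) x = ((‖toCont f x‖ ^ 2 : ℝ) : ℂ) := fun x => by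
      simp [Complex.conj_mul']
    simp only [e]
    rw [integral_complex_ofReal]
    exact_mod_cast integral_nonneg fun x => by positivity

section

variable {A B : Type u} [BooleanAlgebra A] [BooleanAlgebra B] [SigmaComplete A] [SigmaComplete B]

/-- Composition of a bounded abstractly measurable function with an abstractly measurable map. -/
def comp (φ : SigmaHom A B) (f : LInf A) : LInf B :=
  ⟨φ.comp f.1, by
    obtain ⟨M, hM, h⟩ := f.2
    exact ⟨M, hM, by rw [SigmaHom.comp_apply, h, map_top]⟩⟩

theorem comp_map₂ (φ : SigmaHom A B) (op : ℂ × ℂ → ℂ) (hop : Continuous op) (f g : LInf A) :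
    comp φ (map₂ op hop f g) = map₂ op hop (comp φ f) (comp φ g) := by
  have h : φ.comp (pair f g) = pair (comp φ f) (comp φ g) := by
    apply pair_unique
    · rw [pair_fst]
      exact congrArg φ.comp (pair_fst f g)
    · rw [pair_snd]
      exact congrArg φ.comp (pair_snd f g)
  refine ext ?_
  change (φ.comp (pair f g)).comp _ = _
  rw [h]
  rfl

theorem comp_const (φ : SigmaHom A B) (c : ℂ) : comp φ (const c) = const c := by
  refine ext (SigmaHom.ext fun E => ?_)
  classical
  change φ (if c ∈ E.1 then ⊤ else ⊥) = if c ∈ E.1 then ⊤ else ⊥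
  split_ifs
  · exact map_top φ
  · exact map_bot φ

/-- The Koopman operator. -/
def koopman (φ : SigmaHom A B) : LInf A →⋆ₐ[ℂ] LInf B where
  toFun := comp φ
  map_one' := comp_const φ 1
  map_zero' := comp_const φ 0
  map_mul' := comp_map₂ φ _ _
  map_add' := comp_map₂ φ _ _
  commutes' c := by
    rw [Algebra.algebraMap_eq_smul_one, Algebra.algebraMap_eq_smul_one]
    conv_rhs => rw [show (1 : LInf B) = comp φ 1 from (comp_const φ 1).symm]
    rfl
  map_star' _ := rfl

end

end LInf

/-- The functor taking a probability algebra `X` to the tracial commutative `C⋆`-algebra of bounded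
abstractly measurable functions on `X`, and a morphism to its Koopman operator. -/
def LInfFunctor : ProbAlg.{u} ⥤ CStarTr.{u}ᵒᵖ where
  obj X := Opposite.op (LInf.obj X.obj)
  map {X Y} T := Quiver.Hom.op (X := LInf.obj Y.obj) (Y := LInf.obj X.obj)
    (show CStarTr.Hom (LInf.obj Y.obj) (LInf.obj X.obj) from
    { toHom := LInf.koopman ((Inc.map T).pull)
      τ_map := fun f => by
        change ∫ z, z ∂(X.obj.push _) = ∫ z, z ∂(Y.obj.push f.1)
        congr 1
        ext s hs
        rw [AbsProb.push_apply _ _ hs, AbsProb.push_apply _ _ hs]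
        exact (Inc.map T).measure_pull (f.1 ⟨s, hs⟩) })

section Riesz

open ComplexOrder CompactlySupported

theorem riesz_real {X : Type u} [TopologicalSpace X] [CompactSpace X] [T2Space X]
    (Λ : C(X, ℂ) →ₗ[ℂ] ℂ) (h0 : ∀ f, 0 ≤ Λ (star f * f)) (f : C(X, ℝ)) (hf : 0 ≤ f) :
    0 ≤ Λ ⟨fun x => (f x : ℂ), by fun_prop⟩ := by
  have := h0 ⟨fun x => (Real.sqrt (f x) : ℂ), by fun_prop⟩
  convert this using 2
  ext x
  have hx : 0 ≤ f x := hf x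
  simp [← Complex.ofReal_mul, Real.mul_self_sqrt hx]

/-- The Riesz representation theorem for states: every state on `C(X)` is represented by a Baire
probability measure (unique by `baire_measure_ext`, Radon by `isRadon`). -/
theorem exists_riesz {X : Type u} [TopologicalSpace X] [CompactSpace X] [T2Space X]
    (Λ : C(X, ℂ) →ₗ[ℂ] ℂ) (h1 : Λ 1 = 1) (h0 : ∀ f, 0 ≤ Λ (star f * f)) :
    ∃ μ : @Measure X (baire X), IsProbabilityMeasure μ ∧ ∀ f : C(X, ℂ), ∫ x, f x ∂μ = Λ f := by
  let emb : C(X, ℝ) → C(X, ℂ) := fun f => ⟨fun x => (f x : ℂ), by fun_prop⟩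
  have hadd : ∀ f g, emb (f + g) = emb f + emb g := fun f g => by ext x; simp [emb]
  have hsmul : ∀ (c : ℝ) f, emb (c • f) = (c : ℂ) • emb f := fun c f => by ext x; simp [emb]
  have hreal : ∀ f : C(X, ℝ), (Λ (emb f)).im = 0 := by
    intro f
    have e : emb f = emb (f ⊔ 0) - emb ((-f) ⊔ 0) := by
      ext x
      simp only [emb, ContinuousMap.coe_mk, ContinuousMap.sub_apply, ContinuousMap.sup_apply,
        ContinuousMap.zero_apply, ContinuousMap.neg_apply, ← Complex.ofReal_sub]
      congr 1
      exact (posPart_sub_negPart (f x)).symm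
    have p1 := riesz_real Λ h0 (f ⊔ 0) le_sup_right
    have p2 := riesz_real Λ h0 ((-f) ⊔ 0) le_sup_right
    rw [e, map_sub, Complex.sub_im]
    change (Λ _).im - (Λ _).im = 0
    rw [← (Complex.le_def.1 p1).2, ← (Complex.le_def.1 p2).2]
    simp
  let L : C_c(X, ℝ) →ₚ[ℝ] ℝ := PositiveLinearMap.mk₀
    { toFun := fun f => (Λ (emb f.toContinuousMap)).re
      map_add' := fun f g => by
        rw [← Complex.add_re, ← map_add, ← hadd]; rfl
      map_smul' := fun c f => by
        have := hsmul c f.toContinuousMap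
        change (Λ (emb (c • f.toContinuousMap))).re = _
        rw [this, map_smul]
        simp }
    (fun f hf => (Complex.le_def.1 (riesz_real Λ h0 f.toContinuousMap hf)).1)
  let mb : MeasurableSpace X := borel X
  have : BorelSpace X := ⟨rfl⟩
  have hL : ∀ f : C(X, ℝ), ∫ x, f x ∂(RealRMK.rieszMeasure L) = (Λ (emb f)).re := fun f =>
    RealRMK.integral_rieszMeasure L ⟨f, HasCompactSupport.of_compactSpace f⟩
  have hle : baire X ≤ mb := baire_le_borel
  have hprob : IsProbabilityMeasure (RealRMK.rieszMeasure L) := by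
    have h := hL 1
    have e : emb 1 = 1 := by ext x; simp [emb]
    rw [e, h1] at h
    simp [Measure.real, ENNReal.toReal_eq_one_iff] at h
    exact ⟨h⟩
  refine ⟨(RealRMK.rieszMeasure L).trim hle, ⟨by
    rw [trim_measurableSet_eq hle MeasurableSet.univ]; exact measure_univ⟩, fun f => ?_⟩
  have hsm : StronglyMeasurable[baire X] f :=
    (baire_measurable_coe f).stronglyMeasurable
  rw [← integral_trim hle hsm]
  have hint : Integrable f (RealRMK.rieszMeasure L) :=
    f.continuous.integrable_of_hasCompactSupport (HasCompactSupport.of_compactSpace f)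
  have hre := hL ⟨fun x => (f x).re, by fun_prop⟩
  have him := hL ⟨fun x => (f x).im, by fun_prop⟩
  have e : f = emb ⟨fun x => (f x).re, by fun_prop⟩ +
      Complex.I • emb ⟨fun x => (f x).im, by fun_prop⟩ := by
    ext x
    simp only [emb, ContinuousMap.coe_mk, ContinuousMap.add_apply, ContinuousMap.smul_apply,
      smul_eq_mul]
    rw [mul_comm]
    exact (Complex.re_add_im (f x)).symm
  have e2 : ∀ g : C(X, ℝ), Λ (emb g) = ((Λ (emb g)).re : ℂ) := fun g =>
    Complex.ext (by simp) (by simp [hreal g])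
  rw [← integral_re_add_im hint]
  conv_rhs => rw [e, map_add, map_smul, e2 ⟨fun x => (f x).re, _⟩, e2 ⟨fun x => (f x).im, _⟩, ← hre, ← him]
  simp [mul_comm]

end Riesz

namespace CStarTr

open WeakDual

theorem exists_measure (A : CStarTr.{u}) : ∃ μ : @Measure (characterSpace ℂ A) (baire _),
    IsProbabilityMeasure μ ∧ ∀ a : A, ∫ χ, χ a ∂μ = A.τ a := by
  let G := gelfandStarTransform A
  obtain ⟨μ, hμ, h⟩ := exists_riesz (A.τ ∘ₗ (G.symm : C(characterSpace ℂ A, ℂ) →⋆ₐ[ℂ] A).toLinearMap)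
    (by simp [A.τ_one]) (fun f => by
      have := A.τ_nonneg (G.symm f)
      rwa [← map_star, ← map_mul] at this)
  refine ⟨μ, hμ, fun a => ?_⟩
  have e : ∀ χ, G a χ = χ a := fun _ => rfl
  have := h (G a)
  simp only [e] at this
  simpa using this

/-- The unique probability measure on the Gelfand spectrum that represents the state. -/
def rieszMeasure (A : CStarTr.{u}) : @Measure (characterSpace ℂ A) (baire _) :=
  (exists_measure A).choose

instance (A : CStarTr.{u}) : IsProbabilityMeasure A.rieszMeasure := (exists_measure A).choose_spec.1

theorem integral_rieszMeasure (A : CStarTr.{u}) (a : A) :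
    ∫ χ, χ a ∂A.rieszMeasure = A.τ a := (exists_measure A).choose_spec.2 a

/-- The Riesz functor: the Gelfand spectrum of a tracial commutative `C⋆`-algebra with the
probability measure representing the trace. -/
def Riesz : CStarTr.{u}ᵒᵖ ⥤ CHProb.{u} where
  obj A :=
    { top := CompHaus.of (characterSpace ℂ A.unop)
      μ := A.unop.rieszMeasure
      prob := inferInstance
      radon := isRadon _ }
  map {A B} Φ :=
    { toCH := CompHausLike.ofHom _ (CharacterSpace.compContinuousMap
        (show CStarTr.Hom B.unop A.unop from Φ.unop).toHom)
      map_eq := by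
        let φ := show CStarTr.Hom B.unop A.unop from Φ.unop
        let c := CharacterSpace.compContinuousMap φ.toHom
        let mA : MeasurableSpace (characterSpace ℂ A.unop) := baire _
        let mB : MeasurableSpace (characterSpace ℂ B.unop) := baire _
        have hc : Measurable c := baire_measurable c
        change Measure.map c A.unop.rieszMeasure = B.unop.rieszMeasure
        have : IsProbabilityMeasure (Measure.map c A.unop.rieszMeasure) :=
          Measure.isProbabilityMeasure_map hc.aemeasurable
        refine baire_measure_ext _ _ fun f => ?_
        rw [integral_map hc.aemeasurable (baire_measurable_coe f).aestronglyMeasurable]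
        obtain ⟨a, rfl⟩ := (gelfandStarTransform B.unop).surjective f
        exact (integral_rieszMeasure A.unop (φ.toHom a)).trans
          ((φ.τ_map a).trans (integral_rieszMeasure B.unop a).symm) }
  map_id A := CHProb.Hom.ext (by
    change CompHausLike.ofHom _ (CharacterSpace.compContinuousMap (StarAlgHom.id ℂ A.unop)) = _
    rw [CharacterSpace.compContinuousMap_id]
    rfl)
  map_comp {A B C} f g := CHProb.Hom.ext (by rfl)

end CStarTr

/-- The canonical model functor given by Riesz duality. -/
def Stone : ProbAlg.{u} ⥤ CHProb.{u} := LInfFunctor ⋙ CStarTr.Riesz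

/-- The condition characterizing the alternate canonical model functor: its underlying functor to
`CHDelete` is the Loomis–Sikorski functor (so the null sets are the Baire-meager sets), and the
natural monomorphism from an abstract measurable space to its Loomis–Sikorski model is promoted to
a natural monomorphism of abstract probability spaces. -/
def IsAlternateModel (S : ProbAlg.{u} ⥤ CHProb.{u}) : Prop :=
  ∃ h : S ⋙ CHProb.toCHDelete = (Inc ⋙ AbsProb.toAbsMes) ⋙ Loomis,
    ∃ ι : Inc ⟶ S ⋙ CHProb.toAbsProb,
      (∀ X, Mono (ι.app X)) ∧
      Functor.whiskerRight ι AbsProb.toAbsMes =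
        Functor.whiskerLeft (Inc ⋙ AbsProb.toAbsMes) loomisInclusion ≫
          eqToHom (congrArg (· ⋙ CHDelete.toAbsMes) h.symm)

end

end CanonModel


open CanonModel

namespace CanonModel

noncomputable section

/-! Write Σ for the algebra of a probability algebra X, K for its Stone space and λ : Baire(K) → Σ
for the Loomis–Sikorski homomorphism `StoneSpace.lsHom`. The alternate model is K with the
transported measure μ_X ∘ λ. This is countably additive because λ preserves countable joins, and it
is Radon because K is compact. The kernel of λ consists of the Baire-meager sets and μ_X is strictly
positive, so the null sets are exactly the Baire-meager sets (`altStone_null_iff`); this is what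
makes the cast to `CHDelete` equal to `Loomis`. Naturality of λ makes the maps of Stone spaces
measure-preserving (`push_lsHom_map`). By construction λ preserves measure, so it promotes to a
morphism of abstract probability spaces.

For uniqueness, the cast to `CHDelete` already prescribes the spaces and the continuous maps,
leaving only the measure free. A promotion of λ must preserve measure, and this forces the measure
of E to be μ_X(λ(E)) (`CHProb.eq_of_pull`).

For the comparison with `Stone`, the bijection `LInf.toCont` between bounded abstractly measurable
functions and C(K) is a *-isomorphism, so evaluation identifies K with the Gelfand spectrum of
L^∞(X). The trace of f is the integral of `toCont f` against μ_X ∘ λ, so the image of this measure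
on the spectrum represents the trace and is the Riesz measure (`LInf.map_stoneToSpectrum`).
Naturality of this identification is again naturality of λ, in the form `LInf.toCont_comp`. -/

/-! ### Faithfulness of the casting functors -/

instance : CHProb.toCHDelete.{u}.Faithful where
  map_injective h := CHProb.Hom.ext (congrArg CHDelete.Hom.toCH h)

/-- Allows equations between morphisms to be checked on compact Hausdorff spaces. Objects that
differ only in how the null ideal is described become the same object there, so the transports
between them disappear. -/
instance : CHDelete.toCH.{u}.Faithful where
  map_injective h := CHDelete.Hom.ext h

/-- A faithful functor reflects monomorphisms, so a promotion of λ is mono because λ is. -/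
instance : AbsProb.toAbsMes.{u}.Faithful where
  map_injective h := AbsProb.Hom.ext (congrArg Quiver.Hom.unop h)

/-! ### Existence: the measure μ_X ∘ λ on the Stone space -/

/-- The Stone space of a probability algebra, with the measure transported along the
Loomis–Sikorski homomorphism. -/
def loomisProb (X : AbsProb.{u}) : CHProb.{u} where
  top := CompHaus.of (StoneSpace X.alg)
  μ := X.push (StoneSpace.lsHom X.alg)
  prob := inferInstance
  radon := isRadon _

theorem loomisProb_apply (X : AbsProb.{u}) (E : MSet (loomisProb X).top) :
    (loomisProb X).μ E.1 = X.μ (StoneSpace.lsHom X.alg E) :=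
  X.push_apply (StoneSpace.lsHom X.alg) E.2

/-- Naturality of λ rewrites the left-hand measure as μ_X ∘ `f.pull` ∘ λ_Y, and `f.pull` carries μ_Y
to μ_X. This makes the induced map of Stone spaces a `CHProb` morphism. -/
theorem push_lsHom_map {X Y : AbsProb.{u}} (f : AbsProb.Hom X Y) :
    (X.push (StoneSpace.lsHom X.alg)).map (StoneSpace.map f.pull) =
      Y.push (StoneSpace.lsHom Y.alg) := by
  have hf : Measurable (StoneSpace.map f.pull) := baire_measurable (StoneSpace.map f.pull)
  rw [← X.push_preimage _ _ hf, StoneSpace.lsHom_naturality f.pull]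
  refine Measure.ext fun E hE => ?_
  rw [AbsProb.push_apply _ _ hE, AbsProb.push_apply _ _ hE]
  exact f.measure_pull _

/-- The Loomis–Sikorski model of abstract probability spaces. -/
def loomisProbFunctor : AbsProb.{u} ⥤ CHProb.{u} where
  obj := loomisProb
  map {X Y} f :=
    { toCH := CompHausLike.ofHom _ (StoneSpace.map f.pull)
      map_eq := push_lsHom_map f }

/-- The alternate canonical model functor. -/
def altStone : ProbAlg.{u} ⥤ CHProb.{u} := Inc ⋙ loomisProbFunctor

/-- The measure of E is μ_X of its class λ(E). Strict positivity, which enters the proof only here,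
makes this vanish exactly when λ(E) = ⊥, and the kernel of λ is the ideal of Baire-meager sets. -/
theorem altStone_null_iff (X : ProbAlg.{u}) (E : Set (altStone.obj X).top)
    (hE : MeasurableSet E) : (altStone.obj X).μ E = 0 ↔ IsMeagre E := by
  have h : (altStone.obj X).μ E = X.obj.μ (StoneSpace.lsHom X.obj.alg ⟨E, hE⟩) :=
    loomisProb_apply X.obj ⟨E, hE⟩
  rw [h]
  refine Iff.trans ?_ (StoneSpace.lsHom_eq_bot (B := X.obj.alg) (E := ⟨E, hE⟩))
  constructor
  · intro h0
    by_contra hne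
    exact (X.property _ hne).ne' h0
  · intro h0
    rw [h0, X.obj.μ_bot]

/-- Both sides have the same Stone spaces and the same maps by definition. The only gap is between
two descriptions of the null ideal, closed by `altStone_null_iff`. Objects are therefore equal only
propositionally, and the morphisms have to be compared across `eqToHom`. -/
theorem altStone_toCHDelete :
    altStone.{u} ⋙ CHProb.toCHDelete = (Inc ⋙ AbsProb.toAbsMes) ⋙ Loomis := by
  have hobj : ∀ X, (altStone.{u} ⋙ CHProb.toCHDelete).obj X =
      ((Inc ⋙ AbsProb.toAbsMes) ⋙ Loomis).obj X := by
    intro X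
    have e : {E : MSet (altStone.obj X).top | (altStone.obj X).μ E.1 = 0} =
        {E | IsMeagre E.1} := by
      ext E
      exact altStone_null_iff X E.1 E.2
    -- Apart from proofs, only the `null` fields differ, and `congr 1` identifies them by `e`.
    change CHDelete.mk _ _ _ _ _ = CHDelete.mk _ _ _ _ _
    congr 1
  refine CategoryTheory.Functor.ext hobj fun X Y f => CHDelete.toCH.map_injective ?_
  -- After forgetting to `CompHaus`, each `eqToHom` joins definitionally equal objects and is an
  -- identity.
  rw [Functor.map_comp, Functor.map_comp, eqToHom_map, eqToHom_map]
  rfl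

/-- The Loomis–Sikorski inclusion as a transformation of abstract probability spaces. -/
def altStoneInclusion : Inc.{u} ⟶ altStone ⋙ CHProb.toAbsProb where
  app X :=
    { pull := StoneSpace.lsHom X.obj.alg
      measure_pull := fun E => (loomisProb_apply X.obj E).symm }
  naturality _ _ f := AbsProb.Hom.ext
    (StoneSpace.lsHom_naturality (Inc.map f).pull).symm

/-- The homomorphism underlying `altStoneInclusion` is λ itself, so forgetting the measures returns
`loomisInclusion`. -/
theorem isAlternateModel_altStone : IsAlternateModel altStone.{u} := by
  refine ⟨altStone_toCHDelete, altStoneInclusion, fun X => ?_, ?_⟩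
  · have : Mono (AbsProb.toAbsMes.map (altStoneInclusion.app X)) :=
      loomisInclusion_mono (Opposite.op X.obj.alg)
    exact AbsProb.toAbsMes.mono_of_mono_map this
  · ext X
    rw [NatTrans.comp_app, eqToHom_app]
    -- Both ends of the transport unfold to the Baire algebra of the same Stone space, so its
    -- component at X is an identity.
    exact (Category.comp_id _).symm

/-! ### Uniqueness -/

/-- A `CHProb`-space is determined by its underlying space and a homomorphism from its Baire
`σ`-algebra to an abstract probability space that transports the measure. -/
theorem CHProb.eq_of_pull {X : AbsProb.{u}} {Y Z : CHProb.{u}} (e : Y.top = Z.top)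
    (p : X ⟶ CHProb.toAbsProb.obj Y) (q : X ⟶ CHProb.toAbsProb.obj Z)
    (h' : AbsProb.toAbsMes.obj (CHProb.toAbsProb.obj Z) =
      AbsProb.toAbsMes.obj (CHProb.toAbsProb.obj Y))
    (h : AbsProb.toAbsMes.map p = AbsProb.toAbsMes.map q ≫ eqToHom h') : Y = Z := by
  obtain ⟨T, μ, _, _⟩ := Y
  obtain ⟨_, ν, _, _⟩ := Z
  obtain rfl : T = _ := e
  -- Once the two spaces are identified, `h'` equates an object with itself, so its `eqToHom` is the
  -- identity and `h` says that p and q have the same underlying homomorphism.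
  have h1 : p.pull = q.pull :=
    congrArg Quiver.Hom.unop (h.trans (Category.comp_id (AbsProb.toAbsMes.map q)))
  -- Each measure assigns to E the value of the measure of X at the image of E under this common
  -- homomorphism.
  have : μ = ν := by
    ext E hE
    have hp := p.measure_pull ⟨E, hE⟩
    have hq := q.measure_pull ⟨E, hE⟩
    rw [h1] at hp
    exact hp.symm.trans hq
  subst this
  rfl

/-- The cast to `CHDelete` fixes spaces and maps; the condition on `ι` says that its underlying
homomorphism is λ, and preservation of measure then fixes the measure as μ_X ∘ λ. -/
theorem IsAlternateModel.eq_altStone {S : ProbAlg.{u} ⥤ CHProb.{u}} (hS : IsAlternateModel S) :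
    S = altStone := by
  obtain ⟨h, ι, -, hι⟩ := hS
  have hobj : ∀ X, S.obj X = altStone.obj X := by
    intro X
    have hX := NatTrans.congr_app hι X
    rw [NatTrans.comp_app, eqToHom_app] at hX
    -- `altStoneInclusion` serves as the reference: after forgetting measures it is
    -- `loomisInclusion`, with which `hX` compares `ι`.
    exact CHProb.eq_of_pull (congrArg CHDelete.top (Functor.congr_obj h X)) (ι.app X)
      (altStoneInclusion.app X) _ hX
  -- On morphisms, both functors become the Loomis functor after the faithful cast to `CHDelete`.
  refine CategoryTheory.Functor.ext hobj fun X Y f => CHProb.toCHDelete.map_injective ?_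
  rw [Functor.map_comp, Functor.map_comp, eqToHom_map, eqToHom_map]
  exact Functor.congr_hom (h.trans altStone_toCHDelete.symm) f

/-! ### The Stone space as the Gelfand spectrum of L^∞ -/

namespace LInf

open WeakDual

variable {A B : Type u} [BooleanAlgebra A] [BooleanAlgebra B] [SigmaComplete A] [SigmaComplete B]

/-- Under `toCont` the Koopman operator becomes composition with the map of Stone spaces. Writing f
as λ_A after the preimage map of `toCont f`, this is naturality of λ. -/
theorem toCont_comp (φ : SigmaHom A B) (f : LInf A) :
    toCont (comp φ f) = (toCont f).comp (StoneSpace.map φ) := by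
  -- `toCont.symm` is `ofCont`, so the comparison takes place between homomorphisms on the Borel
  -- sets of ℂ.
  apply toCont.symm.injective
  rw [Equiv.symm_apply_apply]
  conv_lhs => rw [← ofCont_toCont f]
  refine ext ?_
  change (φ.comp (StoneSpace.lsHom A)).comp _ = _
  rw [← StoneSpace.lsHom_naturality]
  rfl

/-- The Stone space is the Gelfand spectrum of the algebra of bounded abstractly measurable
functions, via evaluation of the associated continuous functions. -/
def stoneToSpectrum (B : Type u) [BooleanAlgebra B] [SigmaComplete B] :
    C(StoneSpace B, characterSpace ℂ (LInf B)) :=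
  (CharacterSpace.compContinuousMap (toContHom (B := B) : LInf B →⋆ₐ[ℂ] C(StoneSpace B, ℂ))).comp
    (CharacterSpace.continuousMapEval (StoneSpace B) ℂ)

/-- Every character of C(K), for K compact Hausdorff, is evaluation at a unique point, and
precomposition with the *-isomorphism `toContHom` is a bijection of character spaces. -/
theorem bijective_stoneToSpectrum : Function.Bijective (stoneToSpectrum B) := by
  have h1 : Function.Bijective
      (CharacterSpace.compContinuousMap
        (toContHom (B := B) : LInf B →⋆ₐ[ℂ] C(StoneSpace B, ℂ))) :=
    Function.bijective_iff_has_inverse.2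
      ⟨CharacterSpace.compContinuousMap
        ((toContHom (B := B)).symm : C(StoneSpace B, ℂ) →⋆ₐ[ℂ] LInf B),
      fun χ => CharacterSpace.ext fun f =>
        congrArg χ ((toContHom (B := B)).apply_symm_apply f),
      fun χ => CharacterSpace.ext fun f =>
        congrArg χ ((toContHom (B := B)).symm_apply_apply f)⟩
  exact h1.comp (CharacterSpace.continuousMapEval_bijective (StoneSpace B) ℂ)

/-- Both measures represent the trace: the Riesz measure by construction, the image measure by
`AbsProb.trace_eq`, since the Gelfand transform of a pulls back to `toCont a` on the Stone space. A
finite Baire measure is determined by its integrals of continuous functions. -/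
theorem map_stoneToSpectrum (X : AbsProb.{u}) :
    @Measure.map _ _ _ (baire _) (stoneToSpectrum X.alg) (X.push (StoneSpace.lsHom X.alg)) =
      (obj X).rieszMeasure := by
  let m : MeasurableSpace (characterSpace ℂ (LInf X.alg)) := baire _
  have hc : Measurable (stoneToSpectrum X.alg) := baire_measurable (stoneToSpectrum X.alg)
  have : IsProbabilityMeasure
      (Measure.map (stoneToSpectrum X.alg) (X.push (StoneSpace.lsHom X.alg))) :=
    Measure.isProbabilityMeasure_map hc.aemeasurable
  -- The carrier of `obj X` is `LInf X.alg` only after unfolding; `ν` is the Riesz measure restated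
  -- over that type.
  let ν : Measure (characterSpace ℂ (LInf X.alg)) := (obj X).rieszMeasure
  have : IsProbabilityMeasure ν := (CStarTr.exists_measure (obj X)).choose_spec.1
  refine baire_measure_ext (X := characterSpace ℂ (LInf X.alg)) _ ν fun f => ?_
  rw [integral_map hc.aemeasurable (baire_measurable_coe f).aestronglyMeasurable]
  -- Every continuous function on the spectrum is a Gelfand transform, so testing against elements
  -- of the algebra suffices.
  obtain ⟨a, rfl⟩ := (gelfandStarTransform (LInf X.alg)).surjective f
  exact (X.trace_eq a).symm.trans (CStarTr.integral_rieszMeasure (obj X) a).symm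

end LInf

/-! ### The natural isomorphism with `Stone` -/

/-- A continuous measure-preserving bijection of compact Hausdorff probability spaces is an
isomorphism. -/
theorem CHProb.isIso_of_bijective {X Y : CHProb.{u}} (f : X ⟶ Y)
    (hf : Function.Bijective f.toCH) : IsIso f := by
  have : IsIso f.toCH := CompHausLike.isIso_of_bijective f.toCH hf
  refine ⟨⟨inv f.toCH, ?_⟩, CHProb.Hom.ext (IsIso.hom_inv_id f.toCH),
    CHProb.Hom.ext (IsIso.inv_hom_id f.toCH)⟩
  -- The measure of Y is the image of that of X, so its image under the inverse is the image of the
  -- measure of X under the identity.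
  rw [← f.map_eq, Measure.map_map (measurable_compHaus _) (measurable_compHaus _)]
  have e : (inv f.toCH : Y.top → X.top) ∘ f.toCH = id := by
    ext x
    exact ConcreteCategory.congr_hom (IsIso.hom_inv_id f.toCH) x
  rw [e, Measure.map_id]

/-- The comparison between the two canonical model functors. -/
def altStoneToStone : altStone.{u} ⟶ Stone where
  app X :=
    { toCH := CompHausLike.ofHom _ (LInf.stoneToSpectrum X.obj.alg)
      map_eq := LInf.map_stoneToSpectrum X.obj }
  naturality X Y T := by
    refine CHProb.Hom.ext (ConcreteCategory.hom_ext _ _ fun (α : StoneSpace X.obj.alg) => ?_)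
    refine WeakDual.CharacterSpace.ext fun (f : LInf Y.obj.alg) => ?_
    -- At the point α and the function f, the two paths give `toCont f` at the image of α and
    -- `toCont` of the Koopman image of f at α.
    exact (DFunLike.congr_fun (LInf.toCont_comp (Inc.map T).pull f) α).symm

instance (X : ProbAlg.{u}) : IsIso (altStoneToStone.app X) :=
  CHProb.isIso_of_bijective _ LInf.bijective_stoneToSpectrum

end

end CanonModel

open CanonModel
theorem theorem8p7 :
    ∃ S : ProbAlg.{u} ⥤ CHProb.{u},
      IsAlternateModel S ∧ (∀ S' : ProbAlg.{u} ⥤ CHProb.{u}, IsAlternateModel S' → S' = S) ∧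
      (∀ (X : ProbAlg.{u}) (E : Set (S.obj X).top), MeasurableSet E →
        ((S.obj X).μ E = 0 ↔ IsMeagre E)) ∧
      Nonempty (S ≅ Stone) := by
  have : IsIso altStoneToStone.{u} := NatIso.isIso_of_isIso_app _
  exact ⟨altStone, isAlternateModel_altStone, fun _ h => h.eq_altStone, altStone_null_iff,
    ⟨asIso altStoneToStone⟩⟩
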